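/- **Setting.** Let $\Theta_3(u,\tau)=\sum_{n\in\mathbb Z}e^{i\pi\tau n^2+2inu}$. A *wave function* is a $2\pi$-periodic $q:\mathbb R\to\mathbb C$, square integrable over a period; $\langle p|q\rangle=\frac1{2\pi}\int_0^{2\pi}p(x)^*q(x)\,dx$, $q_N=\frac1{2\pi}\int_0^{2\pi}q(x)e^{-iNx}dx$, and its analytic representation is $$Q(z)=\int_0^{2\pi}q(x)\,\Theta_3\!\left[\tfrac{x-z}2;\tfrac i{2\pi}\right]dx\qquad(z\in\mathbb C).$$ For $a\in\mathbb R$, $K\in\mathbb Z$ let $(D(a,K)q)(x)=e^{iK(x-a/2)}q(x-a)$, $(U_0q)(x)=q(-x)$ and $U(a,K)=D(a,K)U_0$. Let $A=[0,2\pi]\times\mathbb R\subset\mathbb C$ and $dm(w)=\frac1{4\pi^{5/2}}e^{-(\operatorname{Im}w)^2}d^2w$. Let $r$ be a normalised wave function, $\langle r|r\rangle=1$, with analytic representation $R$, and let $\mathfrak d(z;a,K;r)$ be the analytic representation of the coherent state $D(a,K)r$. Let $q$ be any wave function, with analytic representation $Q$, and put $$q(a,K;r)=\langle r|D(-a,-K)q\rangle,\qquad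 \widetilde q(b,M;r)=\langle r|U(-b,-M)q\rangle,$$ $$K_c(z,u)=\int_0^{2\pi}\Theta_3\!\left[\tfrac{x-z}2;\tfrac i{2\pi}\right]\Theta_3\!\left[\tfrac{x-u}2;\tfrac i{2\pi}\right]dx.$$ **Proposition.** For all $z,w\in\mathbb C$, $a,b\in\mathbb R$, $K,M\in\mathbb Z$ the following hold; all integrals in (1)–(5) and in the second formula of (6) exist, and all series in (1)–(5) converge absolutely. 1. $\displaystyle\mathfrak d(-z;a,K;r)=\frac1{2\pi}\sum_{M\in\mathbb Z}\int_0^{2\pi}\mathfrak d(z;b,2M-K;r)\,e^{\frac i2(-bK-aK+2Ma)}\,db.$ 2. $\displaystyle\mathfrak d(z;a,K;r)=\exp\!\left(-\tfrac12iKa+iKz-\tfrac12K^2\right)R(z+iK-a).$ The functions $R$ and $\mathfrak d(\cdot;a,K;r)$ are entire, and the zeros of $\mathfrak d(\cdot;a,K;r)$ are exactly the points $\zeta-iK+a$ with $\zeta$ a zero of $R$, with the same multiplicity. 3. $\displaystyle\frac1{4\pi^2}\sum_{K\in\mathbb Z}\int_0^{2\pi}\mathfrak d(z;a,K;r)\,[\mathfrak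 d(w;a,K;r)]^*\,da=K_c(z,w^*)$, and $K_c(z,w^*)=K_c(-z,-w^*)$. 4. $\displaystyle Q(z)=\int_AK_c(z,w^*)\,Q(w)\,dm(w).$ 5. $\displaystyle Q(z)=\frac1{2\pi}\sum_{K}\int_0^{2\pi}\mathfrak d(z;a,K;r)\,q(a,K;r)\,da=\frac1{2\pi}\sum_{M}\int_0^{2\pi}\mathfrak d(-z;b,M;r)\,\widetilde q(b,M;r)\,db,$ where $$q(a+2\pi,K;r)=(-1)^Kq(a,K;r),\qquad\widetilde q(b+2\pi,M;r)=(-1)^M\widetilde q(b,M;r).$$ The inverse relations are $$q(a,K;r)=\frac1{2\pi}\int_A[\mathfrak d(w;a,K;r)]^*Q(w)\,dm(w),\qquad\widetilde q(b,M;r)=\frac1{2\pi}\int_A[\mathfrak d(-w;b,M;r)]^*Q(w)\,dm(w),$$ and $$\widetilde q(b,M;r)=\frac1{2\pi}\sum_{K}\int_0^{2\pi}q(-a,M-2K;r)\,e^{\frac i2(-aM-bM+2Kb)}\,da.$$ 6. (Marginal properties) $$\sum_{K\in\mathbb Z}\mathfrak d(z;a,K;r)=2\pi\,r\!\left(-\tfrac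 a2\right)\Theta_3\!\left[\tfrac{a-2z}4;\tfrac i{2\pi}\right],$$ where the series converges unconditionally in $L^2$ with respect to $a\in[0,4\pi]$, and, in the sense of symmetric partial sums $\sum_{|K|\le n}$, at every point $a$ at which the Fourier series of $r$ (symmetric partial sums) converges to $r$ at $-\frac a2$; and $$\int_0^{2\pi}\mathfrak d(z;a,-2K;r)\,da=4\pi^2\,r_K\,\exp\!\left(-izK-\tfrac12K^2\right).$$ -/

import Mathlib

open scoped Real ComplexConjugate Topology
open Complex (I)

namespace CircleQM

noncomputable section

/-- The theta function `Θ₃(u, τ) = ∑ₙ exp(iπτn² + 2inu)`, which is Mathlib's `jacobiTheta₂`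
up to rescaling the first variable. -/
def theta3 (u τ : ℂ) : ℂ := jacobiTheta₂ (u / π) τ

theorem theta3_eq_tsum (u τ : ℂ) :
    theta3 u τ = ∑' n : ℤ, Complex.exp (I * π * τ * (n : ℂ) ^ 2 + I * 2 * n * u) := by
  have hpi : (π : ℂ) ≠ 0 := by exact_mod_cast Real.pi_ne_zero
  unfold theta3 jacobiTheta₂ jacobiTheta₂_term
  refine tsum_congr fun n => ?_
  congr 1
  field_simp
  ring

/-- The periodised theta kernel `Θ₃[(x - z)/2; i/(2π)]`. -/
def thetaKer (x z : ℂ) : ℂ := theta3 ((x - z) / 2) (I / (2 * π))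

/-- Wave functions of a particle on the circle of radius one: `2π`-periodic functions which are
square integrable over a period. -/
structure IsWaveFunction (q : ℝ → ℂ) : Prop where
  periodic : Function.Periodic q (2 * π)
  memLp : MeasureTheory.MemLp q 2 (MeasureTheory.volume.restrict (Set.Ioc 0 (2 * π)))

/-- The scalar product `⟨p|q⟩ = (1/2π) ∫₀^{2π} p(x)^* q(x) dx`. -/
def braket (p q : ℝ → ℂ) : ℂ := 1 / (2 * π) * ∫ x in (0 : ℝ)..2 * π, conj (p x) * q x

/-- A (normalised) state: a wave function with `(1/2π) ∫₀^{2π} |q(x)|² dx = 1`. -/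
structure IsState (q : ℝ → ℂ) : Prop extends IsWaveFunction q where
  normalized : 1 / (2 * π) * ∫ x in (0 : ℝ)..2 * π, ‖q x‖ ^ 2 = 1

/-- The momentum amplitudes `q_N = (1/2π) ∫₀^{2π} q(x) exp(-iNx) dx`. -/
def momentumCoeff (q : ℝ → ℂ) (N : ℤ) : ℂ :=
  1 / (2 * π) * ∫ x in (0 : ℝ)..2 * π, q x * Complex.exp (-(I * N * x))

/-- The displacement operator `D(a,K)` on wave functions. From
`D(a,K)|x⟩ = exp[iK(x + a/2)] |x + a⟩` and `|q⟩ = (1/2π) ∫ q(x)|x⟩ dx` one gets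
`⟨x|D(a,K)|q⟩ = exp[iK(x - a/2)] q(x - a)`. -/
def displacement (a : ℝ) (K : ℤ) (q : ℝ → ℂ) : ℝ → ℂ :=
  fun x => Complex.exp (I * K * (x - a / 2)) * q (x - a)

/-- The parity operator `U₀ = (1/2π) ∫ |x⟩⟨-x| dx` on wave functions. -/
def parity (q : ℝ → ℂ) : ℝ → ℂ := fun x => q (-x)

/-- The displaced parity operator `U(a,K) = D(a,K) U₀`. -/
def displacedParity (a : ℝ) (K : ℤ) (q : ℝ → ℂ) : ℝ → ℂ := displacement a K (parity q)

/-- The analytic representation `Q(z) = ∫₀^{2π} q(x) Θ₃[(x - z)/2; i/(2π)] dx` of `q`. -/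
def analyticRep (q : ℝ → ℂ) (z : ℂ) : ℂ := ∫ x in (0 : ℝ)..2 * π, q x * thetaKer x z

/-- `𝔡(z; a, K; r)`, the analytic representation of the coherent state `D(a,K)|r⟩`. -/
def coherentRep (z : ℂ) (a : ℝ) (K : ℤ) (r : ℝ → ℂ) : ℂ := analyticRep (displacement a K r) z

/-- The strip `A = [0, 2π] × ℝ` in the complex plane. -/
def strip : Set ℂ := {w | 0 ≤ w.re ∧ w.re ≤ 2 * π}

/-- The measure `dm(z) = (4 π^{5/2})⁻¹ exp(-(Im z)²) d²z`. -/
def dm : MeasureTheory.Measure ℂ :=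
  MeasureTheory.volume.withDensity fun z =>
    ENNReal.ofReal (1 / (4 * π ^ (5 / 2 : ℝ)) * Real.exp (-z.im ^ 2))

/-- The kernel `K_c(z, u) = ∫₀^{2π} Θ₃[(x - z)/2; i/(2π)] Θ₃[(x - u)/2; i/(2π)] dx`
(it is used at `u = w^*`). -/
def kernel (z u : ℂ) : ℂ := ∫ x in (0 : ℝ)..2 * π, thetaKer x z * thetaKer x u

/-- The coefficients `q(a,K;r) = ⟨r|D(-a,-K)|q⟩`. -/
def coeff (q : ℝ → ℂ) (a : ℝ) (K : ℤ) (r : ℝ → ℂ) : ℂ := braket r (displacement (-a) (-K) q)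

/-- The coefficients `q̃(b,M;r) = ⟨r|U(-b,-M)|q⟩`. -/
def coeffTilde (q : ℝ → ℂ) (b : ℝ) (M : ℤ) (r : ℝ → ℂ) : ℂ :=
  braket r (displacedParity (-b) (-M) q)

end

end CircleQM

/-!
Everything is read off from Fourier coefficients. Expanding the theta kernel gives
`Q(z) = 2π ∑ q_N exp(iNz - N²/2)` (`hasSum_analyticRep`), and the displacement operator acts on the
amplitudes by a phase and a shift, `(D(a,K)q)_N = exp(iKa/2 - iNa) q_{N-K}`. This already contains
the relation between `𝔡(·; a, K; r)` and `R`, hence the statement about zeros.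

As a function of `a`, both `𝔡(z; a, K; r)` and `q(a,K;r)` are a phase times an absolutely convergent
trigonometric series, by the Gaussian weights and by Cauchy–Schwarz respectively. Integrals over `a`
against an exponential pick out one coefficient (`integral_trigSeries_mul_exp`), which gives the two
Fourier-type transforms and the second marginal property. Integrals of a product of two such series
are given by Parseval's identity (`hasSum_integral_conj_trigSeries_mul`) as `∑_N |r_{N-K}|² γ_N` with
`γ` summable; summing over `K` turns this into `∑_N γ_N` because `∑ |r_m|² = 1`
(`hasSum_tsum_sq_shift_mul`). This gives the resolution of the identity and the expansions in
coherent states.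

The reproducing kernel and the inverse relations are one statement, `integral_strip_conj_mul`: the
functions `exp(iNw - N²/2)` are orthogonal in `L²(A, dm)` with norm squared `1/(2π)`, and the `L¹`
norms of the products of the `N`-th and `M`-th decay like `exp(-(N-M)²/4)`, so that double series
with square-summable coefficients may be integrated termwise.

All statements about the displaced parity operators reduce to the ordinary ones for the reflected
vector `r(-x)` (`coherentRep_neg`, `coeffTilde_eq`).

For the first marginal property, grouping `∑_{K ∈ s} 𝔡(z; a, K; r)` by `N` gives
`2π ∑_N exp(-iNa/2 + iNz - N²/2) S_{N-s}(-a/2)`, where `S_{N-s}` is the partial Fourier sum of `r` over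
the frequencies `N - K`, `K ∈ s`. For each fixed `N` it converges to `r`, in mean square along all
finite sets and pointwise along symmetric windows, and the Gaussian weights dominate the sum over
`N`.
-/

namespace CircleQM

open MeasureTheory Filter Set

/-! ### Wave functions and Parseval's identity -/

instance fact_two_pi_pos : Fact (0 < 2 * π) := ⟨Real.two_pi_pos⟩

/-- For a periodic function the lift to the circle agrees with the function at every real point,
not only on the fundamental interval. -/
theorem liftIoc_coe {q : ℝ → ℂ} (hq : Function.Periodic q (2 * π)) (x : ℝ) :
    AddCircle.liftIoc (2 * π) 0 q (x : AddCircle (2 * π)) = q x := by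
  obtain ⟨m, hm, -⟩ := existsUnique_add_zsmul_mem_Ioc Real.two_pi_pos x 0
  have hcoe : ((x + m • (2 * π) : ℝ) : AddCircle (2 * π)) = (x : AddCircle (2 * π)) := by
    rw [AddCircle.coe_add, AddCircle.coe_zsmul, AddCircle.coe_period, smul_zero, add_zero]
  rw [← hcoe, AddCircle.liftIoc_coe_apply hm, hq.zsmul m x]

/-- A wave function, seen as a function on the circle, is square integrable. -/
theorem IsWaveFunction.memLp_lift {q : ℝ → ℂ} (hq : IsWaveFunction q) :
    MemLp (AddCircle.liftIoc (2 * π) 0 q) 2 (volume : Measure (AddCircle (2 * π))) := by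
  refine MemLp.memLp_liftIoc ?_
  simpa using hq.memLp

theorem IsWaveFunction.of_memLp_circle {q : ℝ → ℂ} {f : AddCircle (2 * π) → ℂ}
    (hf : MemLp f 2 volume) (h : ∀ x : ℝ, q x = f x) : IsWaveFunction q := by
  refine ⟨fun x => ?_, ?_⟩
  · rw [h, h, AddCircle.coe_add_period]
  · have := hf.comp_measurePreserving (AddCircle.measurePreserving_mk (2 * π) 0)
    rw [zero_add] at this
    exact this.ae_eq (Eventually.of_forall fun x => (h x).symm)

theorem IsWaveFunction.comp_sub {q : ℝ → ℂ} (hq : IsWaveFunction q) (a : ℝ) :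
    IsWaveFunction fun x => q (x - a) := by
  refine .of_memLp_circle (hq.memLp_lift.comp_measurePreserving
    (measurePreserving_sub_right volume (a : AddCircle (2 * π)))) fun x => ?_
  rw [Function.comp_apply, ← AddCircle.coe_sub, liftIoc_coe hq.periodic]

theorem IsWaveFunction.parity {q : ℝ → ℂ} (hq : IsWaveFunction q) :
    IsWaveFunction (parity q) := by
  refine .of_memLp_circle (hq.memLp_lift.comp_measurePreserving
    (Measure.measurePreserving_neg (volume : Measure (AddCircle (2 * π))))) fun x => ?_
  rw [Function.comp_apply, ← AddCircle.coe_neg, liftIoc_coe hq.periodic]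
  rfl

theorem IsWaveFunction.of_continuous {f : ℝ → ℂ} (hf : Continuous f)
    (hp : Function.Periodic f (2 * π)) : IsWaveFunction f := by
  refine ⟨hp, ?_⟩
  obtain ⟨C, hC⟩ := (isCompact_Icc (a := (0 : ℝ)) (b := 2 * π)).exists_bound_of_continuousOn
    hf.continuousOn
  exact MemLp.of_bound hf.aestronglyMeasurable C
    ((ae_restrict_iff' measurableSet_Ioc).2 (.of_forall fun x hx => hC x ⟨hx.1.le, hx.2⟩))

theorem IsWaveFunction.sub {p q : ℝ → ℂ} (hp : IsWaveFunction p) (hq : IsWaveFunction q) :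
    IsWaveFunction fun x => p x - q x :=
  ⟨hp.periodic.sub hq.periodic, hp.memLp.sub hq.memLp⟩

theorem exp_int_periodic (N : ℤ) :
    Function.Periodic (fun x : ℝ => Complex.exp (I * N * x)) (2 * π) := fun x => by
  simp only [Complex.ofReal_add, Complex.ofReal_mul, Complex.ofReal_ofNat, mul_add, Complex.exp_add]
  rw [show I * N * (2 * π) = N * (2 * π * I) by ring, Complex.exp_int_mul_two_pi_mul_I, mul_one]

theorem norm_exp_I_int (N : ℤ) (x : ℝ) : ‖Complex.exp (I * N * x)‖ = 1 := by
  rw [show I * N * x = ((N * x : ℝ) : ℂ) * I by push_cast; ring, Complex.norm_exp_ofReal_mul_I]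

theorem IsWaveFunction.displacement {q : ℝ → ℂ} (hq : IsWaveFunction q) (a : ℝ) (K : ℤ) :
    IsWaveFunction (displacement a K q) := by
  have hs := hq.comp_sub a
  have hexp : ∀ x : ℝ, Complex.exp (I * K * (x - a / 2)) =
      Complex.exp (I * K * x) * Complex.exp (-(I * K * a / 2)) := fun x => by
    rw [← Complex.exp_add]; ring_nf
  have hper : Function.Periodic (fun x : ℝ => Complex.exp (I * K * (x - a / 2))) (2 * π) := by
    intro x
    simp only [hexp]
    exact congrArg (· * _) (exp_int_periodic K x)
  refine ⟨hper.mul hs.periodic, hs.memLp.congr_norm ?_ (.of_forall fun x => ?_)⟩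
  · exact (Continuous.aestronglyMeasurable (by fun_prop)).mul hs.memLp.1
  · have := norm_exp_I_int K (x - a / 2)
    push_cast at this
    simp [CircleQM.displacement, this]

theorem momentumCoeff_eq_fourierCoeff {q : ℝ → ℂ} (hq : IsWaveFunction q) (N : ℤ) :
    momentumCoeff q N = fourierCoeff (AddCircle.liftIoc (2 * π) 0 q) N := by
  rw [fourierCoeff_eq_intervalIntegral _ _ 0, momentumCoeff, Complex.real_smul]
  push_cast
  congr 1
  rw [zero_add]
  refine intervalIntegral.integral_congr fun x _ => ?_
  simp only [liftIoc_coe hq.periodic, fourier_coe_apply, smul_eq_mul]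
  rw [mul_comm]
  congr 2
  push_cast
  have : (π : ℂ) ≠ 0 := by exact_mod_cast Real.pi_ne_zero
  field_simp

/-- Parseval's identity for the scalar product of two wave functions. -/
theorem hasSum_braket {p q : ℝ → ℂ} (hp : IsWaveFunction p) (hq : IsWaveFunction q) :
    HasSum (fun N => conj (momentumCoeff p N) * momentumCoeff q N) (braket p q) := by
  have h1 := hp.memLp_lift.haarAddCircle
  have h2 := hq.memLp_lift.haarAddCircle
  have key := fourierBasis.hasSum_inner_mul_inner h1.toLp h2.toLp
  have hc : ∀ {f : AddCircle (2 * π) → ℂ} (hf : MemLp f 2 AddCircle.haarAddCircle) (N : ℤ),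
      inner ℂ (fourierBasis N) hf.toLp = fourierCoeff f N := fun hf N => by
    rw [← HilbertBasis.repr_apply_apply, fourierBasis_repr, fourierCoeff_congr_ae hf.coeFn_toLp]
  convert! key using 1
  · funext N
    rw [hc, ← inner_conj_symm, hc, momentumCoeff_eq_fourierCoeff hp,
      momentumCoeff_eq_fourierCoeff hq]
  · rw [L2.inner_def]
    trans ∫ t, conj (AddCircle.liftIoc (2 * π) 0 p t) * AddCircle.liftIoc (2 * π) 0 q t
      ∂AddCircle.haarAddCircle
    swap
    · refine integral_congr_ae ?_
      filter_upwards [h1.coeFn_toLp, h2.coeFn_toLp] with t e1 e2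
      rw [e1, e2, RCLike.inner_apply']
    rw [AddCircle.integral_haarAddCircle, ← AddCircle.intervalIntegral_preimage (2 * π) 0,
      braket, Complex.real_smul]
    push_cast
    rw [zero_add, one_div]
    simp only [liftIoc_coe hp.periodic, liftIoc_coe hq.periodic]

theorem braket_self (q : ℝ → ℂ) :
    braket q q = ((1 / (2 * π) * ∫ x in (0 : ℝ)..2 * π, ‖q x‖ ^ 2 : ℝ) : ℂ) := by
  simp only [braket, Complex.conj_mul']
  push_cast
  rw [← intervalIntegral.integral_ofReal]
  push_cast
  rfl

theorem hasSum_norm_sq_momentumCoeff {q : ℝ → ℂ} (hq : IsWaveFunction q) :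
    HasSum (fun N => ‖momentumCoeff q N‖ ^ 2)
      (1 / (2 * π) * ∫ x in (0 : ℝ)..2 * π, ‖q x‖ ^ 2) := by
  have h := hasSum_braket hq hq
  rw [braket_self] at h
  simp only [Complex.conj_mul'] at h
  exact_mod_cast h

theorem exp_neg_int_periodic (N : ℤ) :
    Function.Periodic (fun x : ℝ => Complex.exp (-(I * N * x))) (2 * π) := fun x => by
  have h := exp_int_periodic (-N) x
  simp only [Int.cast_neg, mul_neg, neg_mul] at h ⊢
  exact h

theorem norm_exp_neg_I_int (N : ℤ) (x : ℝ) : ‖Complex.exp (-(I * N * x))‖ = 1 := by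
  have h := norm_exp_I_int (-N) x
  simpa only [Int.cast_neg, mul_neg, neg_mul] using h

/-! ### Momentum amplitudes of displaced and reflected wave functions -/

theorem momentumCoeff_displacement {q : ℝ → ℂ} (hq : Function.Periodic q (2 * π)) (a : ℝ)
    (K N : ℤ) : momentumCoeff (displacement a K q) N =
      Complex.exp (I * K * a / 2 - I * N * a) * momentumCoeff q (N - K) := by
  set f : ℝ → ℂ := fun y => q y * Complex.exp (-(I * (N - K : ℤ) * y)) with hf
  have hper : Function.Periodic f (2 * π) := hq.mul (exp_neg_int_periodic _)
  have h1 : ∀ x : ℝ, displacement a K q x * Complex.exp (-(I * N * x)) =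
      Complex.exp (I * K * a / 2 - I * N * a) * f (x - a) := fun x => by
    simp only [displacement, hf]
    rw [mul_right_comm, mul_left_comm, mul_comm (q _), ← Complex.exp_add, ← Complex.exp_add]
    congr 2
    push_cast
    ring
  simp only [momentumCoeff, h1, intervalIntegral.integral_const_mul]
  rw [intervalIntegral.integral_comp_sub_right f a, zero_sub, sub_eq_add_neg (2 * π),
    add_comm (2 * π), hper.intervalIntegral_add_eq (-a) 0, zero_add]
  ring

theorem momentumCoeff_parity {q : ℝ → ℂ} (hq : Function.Periodic q (2 * π)) (N : ℤ) :
    momentumCoeff (parity q) N = momentumCoeff q (-N) := by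
  set f : ℝ → ℂ := fun y => q y * Complex.exp (-(I * (-N : ℤ) * y)) with hf
  have hper : Function.Periodic f (2 * π) := hq.mul (exp_neg_int_periodic _)
  have h1 : ∀ x : ℝ, parity q x * Complex.exp (-(I * N * x)) = f (-x) := fun x => by
    simp [parity, hf]
  simp only [momentumCoeff, h1]
  rw [intervalIntegral.integral_comp_neg f, neg_zero]
  have := hper.intervalIntegral_add_eq (-(2 * π)) 0
  rw [neg_add_cancel, zero_add] at this
  rw [this]

theorem parity_displacement (a : ℝ) (K : ℤ) (q : ℝ → ℂ) :
    parity (displacement a K q) = displacement (-a) (-K) (parity q) := by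
  funext x
  simp only [parity, displacement]
  congr 1
  · congr 1
    push_cast
    ring
  · congr 1
    ring

/-- The momentum amplitudes of a wave function are bounded. -/
theorem IsWaveFunction.exists_momentumCoeff_le {q : ℝ → ℂ} (hq : IsWaveFunction q) :
    ∃ C, ∀ N, ‖momentumCoeff q N‖ ≤ C := by
  refine ⟨√(1 / (2 * π) * ∫ x in (0 : ℝ)..2 * π, ‖q x‖ ^ 2), fun N => Real.le_sqrt_of_sq_le ?_⟩
  exact le_hasSum (hasSum_norm_sq_momentumCoeff hq) N fun _ _ => by positivity

/-! ### Gaussian weights and the series of the analytic representation -/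

/-- The functions `exp(iNz - N²/2)`; the analytic representation of `q` is `2π ∑ q_N` times them. -/
noncomputable def gaussMode (N : ℤ) (z : ℂ) : ℂ := Complex.exp (I * N * z - (N : ℂ) ^ 2 / 2)

theorem norm_gaussMode (N : ℤ) (z : ℂ) :
    ‖gaussMode N z‖ = Real.exp (-(N : ℝ) ^ 2 / 2 - N * z.im) := by
  rw [gaussMode, Complex.norm_exp]
  congr 1
  have h : (I * N * z - (N : ℂ) ^ 2 / 2) =
      ((N : ℝ) : ℂ) * (I * z) + ((-(N : ℝ) ^ 2 / 2 : ℝ) : ℂ) := by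
    push_cast; ring
  rw [h, Complex.add_re, Complex.re_ofReal_mul, Complex.ofReal_re, Complex.I_mul_re]
  ring

/-- Summability of Gaussians against any polynomial and exponential growth; the terms are, after
rescaling, Mathlib's bound for the Jacobi theta series. -/
theorem summable_abs_pow_mul_exp (c : ℝ) (hc : 0 < c) (S : ℝ) (k : ℕ) :
    Summable fun N : ℤ => |(N : ℝ)| ^ k * Real.exp (-c * (N : ℝ) ^ 2 + S * |(N : ℝ)|) := by
  have h := summable_pow_mul_jacobiTheta₂_term_bound (S / (2 * π)) (div_pos hc Real.pi_pos) k
  refine h.congr fun N => ?_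
  congr 2
  · push_cast; rfl
  · push_cast
    field_simp
    ring

theorem norm_gaussMode_le {S : ℝ} {z : ℂ} (hz : |z.im| ≤ S) (N : ℤ) :
    ‖gaussMode N z‖ ≤ Real.exp (-(1 / 2) * (N : ℝ) ^ 2 + S * |(N : ℝ)|) := by
  rw [norm_gaussMode, Real.exp_le_exp]
  have h1 : -((N : ℝ) * z.im) ≤ |(N : ℝ)| * |z.im| := by
    rw [← abs_mul]; exact neg_le_abs _
  nlinarith [mul_le_mul_of_nonneg_left hz (abs_nonneg (N : ℝ))]

theorem summable_abs_mul_norm_gaussMode (z : ℂ) :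
    Summable fun N : ℤ => |(N : ℝ)| * ‖gaussMode N z‖ := by
  refine .of_nonneg_of_le (fun _ => by positivity) (fun N => ?_)
    (summable_abs_pow_mul_exp (1 / 2) (by norm_num) |z.im| 1)
  rw [pow_one]
  exact mul_le_mul_of_nonneg_left (norm_gaussMode_le le_rfl N) (abs_nonneg _)

theorem summable_norm_gaussMode (z : ℂ) : Summable fun N : ℤ => ‖gaussMode N z‖ := by
  refine .of_nonneg_of_le (fun _ => norm_nonneg _) (fun N => ?_)
    (summable_abs_pow_mul_exp (1 / 2) (by norm_num) |z.im| 0)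
  rw [pow_zero, one_mul]
  exact norm_gaussMode_le le_rfl N

theorem summable_norm_mul_gaussMode {α : ℤ → ℂ} {C : ℝ} (hα : ∀ N, ‖α N‖ ≤ C) (z : ℂ) :
    Summable fun N : ℤ => ‖α N * gaussMode N z‖ := by
  refine .of_nonneg_of_le (fun _ => norm_nonneg _) (fun N => ?_)
    ((summable_norm_gaussMode z).mul_left C)
  rw [norm_mul]
  exact mul_le_mul_of_nonneg_right (hα N) (norm_nonneg _)

/-- The theta series at nome `exp(-1/2)`, written with the sign of `N` reversed (the series is even
in `u`), so that it pairs with the exponentials defining the momentum amplitudes. -/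
theorem hasSum_theta3 (u : ℂ) :
    HasSum (fun N : ℤ => Complex.exp (-(I * 2 * N * u) - (N : ℂ) ^ 2 / 2))
      (theta3 u (I / (2 * π))) := by
  have hpi : (π : ℂ) ≠ 0 := by exact_mod_cast Real.pi_ne_zero
  have him : 0 < (I / (2 * π) : ℂ).im := by
    rw [show (I / (2 * π) : ℂ) = ((1 / (2 * π) : ℝ) : ℂ) * I by push_cast; ring,
      Complex.im_ofReal_mul, Complex.I_im]
    positivity
  have h := hasSum_jacobiTheta₂_term (-(u / π)) him
  rw [jacobiTheta₂_neg_left] at h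
  convert! h using 1
  funext N
  rw [jacobiTheta₂_term]
  congr 1
  field_simp
  linear_combination (-(N : ℂ) ^ 2) * Complex.I_sq

theorem hasSum_thetaKer (x z : ℂ) :
    HasSum (fun N : ℤ => Complex.exp (-(I * N * x)) * gaussMode N z) (thetaKer x z) := by
  convert! hasSum_theta3 ((x - z) / 2) using 1
  funext N
  rw [gaussMode, ← Complex.exp_add]
  congr 1
  ring

/-- The Fourier expansion of the analytic representation. -/
theorem hasSum_analyticRep {q : ℝ → ℂ} (hq : IsWaveFunction q) (z : ℂ) :
    HasSum (fun N : ℤ => 2 * π * momentumCoeff q N * gaussMode N z) (analyticRep q z) := by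
  have hpi : (π : ℂ) ≠ 0 := by exact_mod_cast Real.pi_ne_zero
  have hint : IntegrableOn q (Ioc 0 (2 * π)) := hq.memLp.integrable (by norm_num)
  have key : HasSum (fun N : ℤ => ∫ x in (0 : ℝ)..2 * π,
      q x * (Complex.exp (-(I * N * x)) * gaussMode N z)) (analyticRep q z) := by
    refine intervalIntegral.hasSum_integral_of_dominated_convergence
      (fun N x => ‖q x‖ * ‖gaussMode N z‖) (fun N => ?_) (fun N => ?_) ?_ ?_ ?_
    · rw [uIoc_of_le Real.two_pi_pos.le]
      exact hint.aestronglyMeasurable.mul (Continuous.aestronglyMeasurable (by fun_prop))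
    · exact .of_forall fun x _ => by rw [norm_mul, norm_mul, norm_exp_neg_I_int, one_mul]
    · exact .of_forall fun x _ => (summable_norm_gaussMode z).mul_left _
    · simp only [tsum_mul_left]
      rw [intervalIntegrable_iff, uIoc_of_le Real.two_pi_pos.le]
      exact hint.norm.mul_const _
    · exact .of_forall fun x _ => (hasSum_thetaKer x z).mul_left _
  convert! key using 1
  funext N
  simp only [← mul_assoc, intervalIntegral.integral_mul_const, momentumCoeff]
  field_simp

theorem differentiable_analyticRep {q : ℝ → ℂ} (hq : IsWaveFunction q) :
    Differentiable ℂ (analyticRep q) := by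
  obtain ⟨C, hC⟩ := hq.exists_momentumCoeff_le
  have hC0 : 0 ≤ C := (norm_nonneg _).trans (hC 0)
  intro z
  -- The series converges uniformly on horizontal strips, where `|Im w|` is bounded.
  set U : Set ℂ := {w | |w.im| < |z.im| + 1}
  have hU : IsOpen U := isOpen_lt (by fun_prop) continuous_const
  have h : DifferentiableOn ℂ
      (fun w => ∑' N : ℤ, 2 * π * momentumCoeff q N * gaussMode N w) U := by
    refine Complex.differentiableOn_tsum_of_summable_norm
      ((summable_abs_pow_mul_exp (1 / 2) (by norm_num) (|z.im| + 1) 0).mul_left (2 * π * C))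
      (fun N => ?_) hU fun N w hw => ?_
    · unfold gaussMode
      fun_prop
    · rw [pow_zero, one_mul, norm_mul, norm_mul]
      have : ‖(2 * π : ℂ)‖ = 2 * π := by
        rw [norm_mul, Complex.norm_real, Real.norm_of_nonneg Real.pi_pos.le]; simp
      rw [this]
      exact mul_le_mul (mul_le_mul_of_nonneg_left (hC N) (by positivity))
        (norm_gaussMode_le (le_of_lt hw) N) (norm_nonneg _) (by positivity)
  have heq : (fun w => ∑' N : ℤ, 2 * π * momentumCoeff q N * gaussMode N w) = analyticRep q :=
    funext fun w => (hasSum_analyticRep hq w).tsum_eq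
  rw [heq] at h
  exact h.differentiableAt (hU.mem_nhds (by simp [U]))

/-- Reflecting the argument of an analytic representation amounts to applying parity to the wave
function, because the Gaussian weights are even in `N`. -/
theorem analyticRep_neg {q : ℝ → ℂ} (hq : IsWaveFunction q) (z : ℂ) :
    analyticRep q (-z) = analyticRep (parity q) z := by
  refine (hasSum_analyticRep hq (-z)).unique ?_
  rw [← (Equiv.neg ℤ).hasSum_iff]
  convert! hasSum_analyticRep hq.parity z using 1
  funext N
  rw [momentumCoeff_parity hq.periodic, Function.comp_apply, Equiv.neg_apply, gaussMode, gaussMode]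
  push_cast
  congr 2
  ring

/-- A reflected coherent state is a coherent state of the reflected fiducial vector. -/
theorem coherentRep_neg {r : ℝ → ℂ} (hr : IsWaveFunction r) (z : ℂ) (a : ℝ) (K : ℤ) :
    coherentRep (-z) a K r = coherentRep z (-a) (-K) (parity r) := by
  rw [coherentRep, analyticRep_neg (hr.displacement a K), parity_displacement, coherentRep]

theorem hasSum_coherentRep {r : ℝ → ℂ} (hr : IsWaveFunction r) (z : ℂ) (a : ℝ) (K : ℤ) :
    HasSum (fun N : ℤ => 2 * π * (Complex.exp (I * K * a / 2 - I * N * a) *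
      momentumCoeff r (N - K)) * gaussMode N z) (coherentRep z a K r) := by
  have h := hasSum_analyticRep (hr.displacement a K) z
  simp only [momentumCoeff_displacement hr.periodic] at h
  exact h

theorem coherentRep_eq_exp_mul {r : ℝ → ℂ} (hr : IsWaveFunction r) (z : ℂ) (a : ℝ) (K : ℤ) :
    coherentRep z a K r = Complex.exp (-(1 / 2) * I * K * a + I * K * z - 1 / 2 * (K : ℂ) ^ 2) *
      analyticRep r (z + I * K - a) := by
  refine (hasSum_coherentRep hr z a K).unique ?_
  -- Substituting `N + K` for `N`, the cross term `-NK` of `(N + K)² / 2` is what shifts `z` by `iK`.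
  rw [← (Equiv.addRight K).hasSum_iff]
  convert! (hasSum_analyticRep hr (z + I * K - a)).mul_left
    (Complex.exp (-(1 / 2) * I * K * a + I * K * z - 1 / 2 * (K : ℂ) ^ 2)) using 1
  funext N
  simp only [Function.comp_apply, Equiv.coe_addRight, add_sub_cancel_right, gaussMode]
  have h : Complex.exp (I * K * a / 2 - I * (N + K : ℤ) * a) *
      Complex.exp (I * (N + K : ℤ) * z - ((N + K : ℤ) : ℂ) ^ 2 / 2) =
      Complex.exp (-(1 / 2) * I * K * a + I * K * z - 1 / 2 * (K : ℂ) ^ 2) *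
        Complex.exp (I * N * (z + I * K - a) - (N : ℂ) ^ 2 / 2) := by
    rw [← Complex.exp_add, ← Complex.exp_add]
    congr 1
    push_cast
    linear_combination (-(N : ℂ) * K) * Complex.I_sq
  linear_combination (2 * π * momentumCoeff r N) * h

/-! ### Absolutely convergent trigonometric series -/

/-- The trigonometric series `∑ β_N exp(-iNx)`, with the sign of the exponent in which the
coherent states depend on their position parameter. -/
noncomputable def trigSeries (β : ℤ → ℂ) (x : ℝ) : ℂ := ∑' N : ℤ, β N * Complex.exp (-(I * N * x))

theorem hasSum_trigSeries {β : ℤ → ℂ} (hβ : Summable fun N => ‖β N‖) (x : ℝ) :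
    HasSum (fun N : ℤ => β N * Complex.exp (-(I * N * x))) (trigSeries β x) := by
  refine (Summable.of_norm ?_).hasSum
  simpa only [norm_mul, norm_exp_neg_I_int, mul_one] using hβ

theorem continuous_trigSeries {β : ℤ → ℂ} (hβ : Summable fun N => ‖β N‖) :
    Continuous (trigSeries β) := by
  refine continuous_tsum (fun N => by fun_prop) hβ fun N x => ?_
  rw [norm_mul, norm_exp_neg_I_int, mul_one]

theorem periodic_trigSeries (β : ℤ → ℂ) : Function.Periodic (trigSeries β) (2 * π) := fun x =>
  tsum_congr fun N => congrArg (β N * ·) (exp_neg_int_periodic N x)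

theorem isWaveFunction_trigSeries {β : ℤ → ℂ} (hβ : Summable fun N => ‖β N‖) :
    IsWaveFunction (trigSeries β) :=
  .of_continuous (continuous_trigSeries hβ) (periodic_trigSeries β)

theorem conj_exp_I_mul (N : ℤ) (x : ℝ) :
    conj (Complex.exp (-(I * N * x))) = Complex.exp (I * N * x) := by
  rw [← Complex.exp_conj]
  simp

theorem conj_trigSeries (β : ℤ → ℂ) (x : ℝ) :
    conj (trigSeries β x) = trigSeries (fun N => conj (β N)) (-x) := by
  rw [trigSeries, Complex.conj_tsum, trigSeries]
  refine tsum_congr fun N => ?_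
  rw [map_mul, conj_exp_I_mul]
  push_cast
  rw [mul_neg, neg_neg]

theorem integral_exp_int (N : ℤ) :
    ∫ x in (0 : ℝ)..2 * π, Complex.exp (I * N * x) = (if N = 0 then 2 * π else 0 : ℂ) := by
  split_ifs with h
  · simp [h]
  · have hN : I * N ≠ 0 := mul_ne_zero Complex.I_ne_zero (by exact_mod_cast h)
    rw [integral_exp_mul_complex hN]
    have h2 : I * N * ((2 * π : ℝ) : ℂ) = N * (2 * π * I) := by push_cast; ring
    rw [h2, Complex.exp_int_mul_two_pi_mul_I]
    simp

theorem integral_trigSeries_mul_exp {β : ℤ → ℂ} (hβ : Summable fun N => ‖β N‖) (M : ℤ) :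
    ∫ x in (0 : ℝ)..2 * π, trigSeries β x * Complex.exp (I * M * x) = 2 * π * β M := by
  have key : HasSum (fun N : ℤ => ∫ x in (0 : ℝ)..2 * π,
      β N * Complex.exp (-(I * N * x)) * Complex.exp (I * M * x))
      (∫ x in (0 : ℝ)..2 * π, trigSeries β x * Complex.exp (I * M * x)) := by
    refine intervalIntegral.hasSum_integral_of_dominated_convergence
      (fun N _ => ‖β N‖) (fun N => ?_) (fun N => ?_) ?_ ?_ ?_
    · exact Continuous.aestronglyMeasurable (by fun_prop)
    · exact .of_forall fun x _ => by
        rw [norm_mul, norm_mul, norm_exp_neg_I_int, norm_exp_I_int, mul_one, mul_one]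
    · exact .of_forall fun x _ => hβ
    · exact intervalIntegrable_const
    · exact .of_forall fun x _ => (hasSum_trigSeries hβ x).mul_right _
  have hterm : ∀ N : ℤ, ∫ x in (0 : ℝ)..2 * π,
      β N * Complex.exp (-(I * N * x)) * Complex.exp (I * M * x) =
        if N = M then 2 * π * β M else 0 := fun N => by
    have h : ∀ x : ℝ, β N * Complex.exp (-(I * N * x)) * Complex.exp (I * M * x) =
        β N * Complex.exp (I * (M - N : ℤ) * x) := fun x => by
      rw [mul_assoc, ← Complex.exp_add]
      push_cast
      ring_nf
    simp only [h, intervalIntegral.integral_const_mul, integral_exp_int]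
    rcases eq_or_ne N M with rfl | hne
    · simp [mul_comm]
    · rw [if_neg (sub_ne_zero.2 hne.symm), if_neg hne, mul_zero]
  simp only [hterm] at key
  exact key.unique (hasSum_ite_eq M _)

/-- The sign comes from the exponent `-iNx` in `trigSeries`. -/
theorem momentumCoeff_trigSeries {β : ℤ → ℂ} (hβ : Summable fun N => ‖β N‖) (N : ℤ) :
    momentumCoeff (trigSeries β) N = β (-N) := by
  have h := integral_trigSeries_mul_exp hβ (-N)
  push_cast at h
  simp only [mul_neg, neg_mul] at h
  have hpi : (π : ℂ) ≠ 0 := by exact_mod_cast Real.pi_ne_zero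
  rw [momentumCoeff, h]
  field_simp

theorem hasSum_integral_conj_trigSeries_mul {α β : ℤ → ℂ} (hα : Summable fun N => ‖α N‖)
    (hβ : Summable fun N => ‖β N‖) :
    HasSum (fun N => 2 * π * (conj (α N) * β N))
      (∫ x in (0 : ℝ)..2 * π, conj (trigSeries α x) * trigSeries β x) := by
  have h := hasSum_braket (isWaveFunction_trigSeries hα) (isWaveFunction_trigSeries hβ)
  simp only [momentumCoeff_trigSeries hα, momentumCoeff_trigSeries hβ] at h
  rw [← (Equiv.neg ℤ).hasSum_iff]
  convert! h.mul_left (2 * π : ℂ) using 1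
  have hpi : (π : ℂ) ≠ 0 := by exact_mod_cast Real.pi_ne_zero
  rw [braket]
  field_simp

/-! ### Square-summable sequences -/

theorem summable_norm_mul_of_sq {α β : ℤ → ℂ} (hα : Summable fun N => ‖α N‖ ^ 2)
    (hβ : Summable fun N => ‖β N‖ ^ 2) : Summable fun N => ‖α N * β N‖ := by
  refine .of_nonneg_of_le (fun _ => norm_nonneg _) (fun N => ?_) (hα.add hβ)
  rw [norm_mul]
  nlinarith [sq_nonneg (‖α N‖ - ‖β N‖), sq_nonneg ‖α N‖, sq_nonneg ‖β N‖]

/-- Averaging a summable sequence against the translates of a probability weight `|ρ|²`. -/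
theorem hasSum_tsum_sq_shift_mul {ρ γ : ℤ → ℂ} (hρ : HasSum (fun N => ‖ρ N‖ ^ 2) 1)
    (hγ : Summable fun N => ‖γ N‖) :
    HasSum (fun K => ∑' N, (‖ρ (N - K)‖ : ℂ) ^ 2 * γ N) (∑' N, γ N) := by
  have hρc : HasSum (fun N => (‖ρ N‖ : ℂ) ^ 2) 1 := by
    have h := Complex.hasSum_ofReal.2 hρ
    push_cast at h
    exact h
  have hn : Summable fun N => ‖(‖ρ N‖ : ℂ) ^ 2‖ := by simpa using hρ.summable
  have hs : Summable fun p : ℤ × ℤ => ‖(‖ρ p.1‖ : ℂ) ^ 2 * γ p.2‖ := hn.mul_norm hγ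
  have hprod : HasSum (fun p : ℤ × ℤ => (‖ρ p.1‖ : ℂ) ^ 2 * γ p.2) (1 * ∑' N, γ N) :=
    hρc.mul hγ.of_norm.hasSum hs.of_norm
  rw [one_mul] at hprod
  -- `(K, N) ↦ (N - K, N)` is an involution of `ℤ × ℤ`.
  let e : ℤ × ℤ ≃ ℤ × ℤ :=
    { toFun := fun p => (p.2 - p.1, p.2)
      invFun := fun p => (p.2 - p.1, p.2)
      left_inv := fun p => by simp
      right_inv := fun p => by simp }
  have h2 := e.hasSum_iff.2 hprod
  refine h2.prod_fiberwise fun K => ?_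
  exact (h2.summable.prod_factor K).hasSum

/-! ### Coherent states as functions of their position parameter -/

theorem IsWaveFunction.summable_sq {q : ℝ → ℂ} (hq : IsWaveFunction q) :
    Summable fun N => ‖momentumCoeff q N‖ ^ 2 := (hasSum_norm_sq_momentumCoeff hq).summable

theorem IsState.hasSum_sq {r : ℝ → ℂ} (hr : IsState r) :
    HasSum (fun N => ‖momentumCoeff r N‖ ^ 2) 1 :=
  hr.normalized ▸ hasSum_norm_sq_momentumCoeff hr.toIsWaveFunction

theorem IsState.parity {r : ℝ → ℂ} (hr : IsState r) : IsState (parity r) where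
  toIsWaveFunction := hr.toIsWaveFunction.parity
  normalized := by
    have h := hasSum_norm_sq_momentumCoeff hr.toIsWaveFunction.parity
    simp only [momentumCoeff_parity hr.periodic] at h
    exact h.unique ((Equiv.neg ℤ).hasSum_iff.2 hr.hasSum_sq)

theorem summable_shift_mul_gaussMode {r : ℝ → ℂ} (hr : IsWaveFunction r) (z : ℂ) (K : ℤ) :
    Summable fun N => ‖momentumCoeff r (N - K) * gaussMode N z‖ :=
  let ⟨_, hC⟩ := hr.exists_momentumCoeff_le
  summable_norm_mul_gaussMode (fun N => hC (N - K)) z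

theorem summable_conj_shift_mul {r q : ℝ → ℂ} (hr : IsWaveFunction r) (hq : IsWaveFunction q)
    (K : ℤ) : Summable fun N => ‖conj (momentumCoeff r (N - K)) * momentumCoeff q N‖ := by
  refine summable_norm_mul_of_sq ?_ hq.summable_sq
  simp only [RCLike.norm_conj]
  exact (Equiv.subRight K).summable_iff.2 hr.summable_sq

/-- Up to a phase, a coherent state is an absolutely convergent trigonometric series in its position
parameter. -/
theorem coherentRep_eq_trigSeries {r : ℝ → ℂ} (hr : IsWaveFunction r) (z : ℂ) (a : ℝ) (K : ℤ) :
    coherentRep z a K r = 2 * π * Complex.exp (I * K * a / 2) *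
      trigSeries (fun N => momentumCoeff r (N - K) * gaussMode N z) a := by
  refine (hasSum_coherentRep hr z a K).unique ?_
  convert! (hasSum_trigSeries (summable_shift_mul_gaussMode hr z K) a).mul_left
    (2 * π * Complex.exp (I * K * a / 2)) using 1
  funext N
  rw [sub_eq_add_neg (I * K * a / 2), Complex.exp_add]
  ring

theorem continuous_coherentRep {r : ℝ → ℂ} (hr : IsWaveFunction r) (z : ℂ) (K : ℤ) :
    Continuous fun a : ℝ => coherentRep z a K r := by
  simp only [coherentRep_eq_trigSeries hr]
  have := continuous_trigSeries (summable_shift_mul_gaussMode hr z K)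
  fun_prop

/-- Parseval's identity for `⟨r|D(-a,-K)q⟩ = ⟨D(a,K)r|q⟩`. -/
theorem hasSum_coeff {r q : ℝ → ℂ} (hr : IsWaveFunction r) (hq : IsWaveFunction q) (a : ℝ)
    (K : ℤ) : HasSum (fun N => conj (momentumCoeff (displacement a K r) N) * momentumCoeff q N)
      (coeff q a K r) := by
  have h := hasSum_braket hr (hq.displacement (-a) (-K))
  rw [← (Equiv.subRight K).hasSum_iff] at h
  convert! h using 1
  funext N
  rw [Function.comp_apply, Equiv.subRight_apply, momentumCoeff_displacement hr.periodic,
    momentumCoeff_displacement hq.periodic, sub_neg_eq_add, sub_add_cancel, map_mul,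
    ← Complex.exp_conj]
  have : conj (I * K * a / 2 - I * N * a) =
      I * ((-K : ℤ) : ℂ) * ((-a : ℝ) : ℂ) / 2 - I * ((N - K : ℤ) : ℂ) * ((-a : ℝ) : ℂ) := by
    simp only [map_sub, map_div₀, map_mul, Complex.conj_I, Complex.conj_ofReal, map_intCast,
      map_ofNat]
    push_cast
    ring
  rw [this]
  ring

/-- Up to the phase conjugate to that of `coherentRep`, a coefficient is an absolutely convergent
trigonometric series in `-a`; absolute convergence is Cauchy–Schwarz for two `ℓ²` sequences. -/
theorem coeff_eq_trigSeries {r q : ℝ → ℂ} (hr : IsWaveFunction r) (hq : IsWaveFunction q) (a : ℝ)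
    (K : ℤ) : coeff q a K r = Complex.exp (-(I * K * a / 2)) *
      trigSeries (fun N => conj (momentumCoeff r (N - K)) * momentumCoeff q N) (-a) := by
  refine (hasSum_coeff hr hq a K).unique ?_
  convert! (hasSum_trigSeries (summable_conj_shift_mul hr hq K) (-a)).mul_left
    (Complex.exp (-(I * K * a / 2))) using 1
  funext N
  rw [momentumCoeff_displacement hr.periodic, map_mul, ← Complex.exp_conj]
  have : conj (I * K * a / 2 - I * N * a) =
      -(I * K * a / 2) + -(I * N * ((-a : ℝ) : ℂ)) := by
    simp only [map_sub, map_div₀, map_mul, Complex.conj_I, Complex.conj_ofReal, map_intCast,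
      map_ofNat]
    push_cast
    ring
  rw [this, Complex.exp_add]
  ring

theorem continuous_coeff {r q : ℝ → ℂ} (hr : IsWaveFunction r) (hq : IsWaveFunction q) (K : ℤ) :
    Continuous fun a : ℝ => coeff q a K r := by
  simp only [coeff_eq_trigSeries hr hq]
  have := continuous_trigSeries (summable_conj_shift_mul hr hq K)
  fun_prop

theorem displacedParity_eq (b : ℝ) (M : ℤ) (q : ℝ → ℂ) :
    displacedParity b M q = parity (displacement (-b) (-M) q) := by
  rw [parity_displacement, neg_neg, neg_neg, displacedParity]

/-- The coefficients with displaced parity operators are the ordinary ones for the reflected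
fiducial vector. Together with `coherentRep_neg` this reduces every statement about them to the
ordinary coefficients. -/
theorem coeffTilde_eq {r q : ℝ → ℂ} (hr : IsWaveFunction r) (hq : IsWaveFunction q) (b : ℝ)
    (M : ℤ) : coeffTilde q b M r = coeff q (-b) (-M) (parity r) := by
  rw [coeffTilde, displacedParity_eq, coeff]
  set f := displacement (- -b) (- -M) q
  have hf : IsWaveFunction f := hq.displacement _ _
  refine (hasSum_braket hr hf.parity).unique ?_
  rw [← (Equiv.neg ℤ).hasSum_iff]
  convert! hasSum_braket hr.parity hf using 1
  funext N
  rw [Function.comp_apply, Equiv.neg_apply, momentumCoeff_parity hr.periodic,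
    momentumCoeff_parity hf.periodic, neg_neg]

theorem coeff_add_two_pi (r q : ℝ → ℂ) (hq : Function.Periodic q (2 * π)) (a : ℝ) (K : ℤ) :
    coeff q (a + 2 * π) K r = (-1) ^ K * coeff q a K r := by
  have hd : ∀ x, displacement (-(a + 2 * π)) (-K) q x =
      (-1) ^ K * displacement (-a) (-K) q x := fun x => by
    have hexp : Complex.exp (I * ((-K : ℤ) : ℂ) * (x - ((-(a + 2 * π) : ℝ) : ℂ) / 2)) =
        (-1) ^ K * Complex.exp (I * ((-K : ℤ) : ℂ) * (x - ((-a : ℝ) : ℂ) / 2)) := by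
      rw [← Int.neg_neg K, zpow_neg, ← inv_zpow, inv_neg_one, ← Complex.exp_pi_mul_I,
        ← Complex.exp_int_mul, ← Complex.exp_add]
      congr 1
      push_cast
      ring
    simp only [displacement]
    rw [hexp, show x - -(a + 2 * π) = x - -a + 2 * π by ring, hq, mul_assoc]
  simp only [coeff, braket, hd, mul_left_comm _ ((-1 : ℂ) ^ K),
    intervalIntegral.integral_const_mul]

theorem coeffTilde_add_two_pi {r q : ℝ → ℂ} (hr : IsWaveFunction r) (hq : IsWaveFunction q)
    (b : ℝ) (M : ℤ) : coeffTilde q (b + 2 * π) M r = (-1) ^ M * coeffTilde q b M r := by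
  rw [coeffTilde_eq hr hq, coeffTilde_eq hr hq,
    show -b = -(b + 2 * π) + 2 * π by ring, coeff_add_two_pi _ _ hq.periodic (-(b + 2 * π)),
    ← mul_assoc, zpow_neg, mul_inv_cancel₀ (zpow_ne_zero _ (by norm_num)), one_mul]

/-! ### The resolution of the identity -/

theorem gaussMode_neg (N : ℤ) (z : ℂ) : gaussMode (-N) (-z) = gaussMode N z := by
  rw [gaussMode, gaussMode]
  congr 1
  push_cast
  ring

theorem conj_gaussMode (N : ℤ) (z : ℂ) : conj (gaussMode N z) = gaussMode (-N) (conj z) := by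
  rw [gaussMode, gaussMode, ← Complex.exp_conj]
  congr 1
  simp only [map_sub, map_div₀, map_mul, map_pow, Complex.conj_I, map_intCast, map_ofNat]
  push_cast
  ring

theorem thetaKer_eq_trigSeries (x : ℝ) (z : ℂ) :
    thetaKer x z = trigSeries (fun N => gaussMode N z) x := by
  refine (hasSum_thetaKer x z).unique ?_
  convert! hasSum_trigSeries (summable_norm_gaussMode z) x using 1
  funext N
  rw [mul_comm]

theorem thetaKer_conj (x : ℝ) (z : ℂ) : thetaKer x (conj z) = conj (thetaKer x z) := by
  rw [thetaKer_eq_trigSeries, thetaKer_eq_trigSeries, conj_trigSeries]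
  refine ((Equiv.neg ℤ).tsum_eq _).symm.trans (tsum_congr fun N => ?_)
  simp only [conj_gaussMode, Equiv.neg_apply]
  push_cast
  congr 3
  ring

/-- The Mercer-type expansion of the kernel `K_c(z, w^*)`. -/
theorem hasSum_kernel (z w : ℂ) :
    HasSum (fun N => 2 * π * (conj (gaussMode N w) * gaussMode N z)) (kernel z (conj w)) := by
  have h := hasSum_integral_conj_trigSeries_mul (summable_norm_gaussMode w)
    (summable_norm_gaussMode z)
  convert! h using 1
  simp only [kernel, thetaKer_conj, ← thetaKer_eq_trigSeries, mul_comm]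

theorem kernel_neg (z w : ℂ) : kernel z (conj w) = kernel (-z) (-conj w) := by
  rw [← map_neg]
  refine (hasSum_kernel z w).unique ?_
  rw [← (Equiv.neg ℤ).hasSum_iff]
  convert! hasSum_kernel (-z) (-w) using 1
  funext N
  rw [Function.comp_apply, Equiv.neg_apply, ← gaussMode_neg, ← gaussMode_neg (-N), neg_neg]

theorem exp_mul_conj_exp (K : ℤ) (a : ℝ) :
    Complex.exp (I * K * a / 2) * conj (Complex.exp (I * K * a / 2)) = 1 := by
  rw [← Complex.exp_conj, ← Complex.exp_add]
  simp only [map_div₀, map_mul, Complex.conj_I, Complex.conj_ofReal, map_intCast, map_ofNat]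
  rw [Complex.exp_eq_one_iff]
  exact ⟨0, by push_cast; ring⟩

/-- Parseval's identity in the position parameter; the phases of the two factors cancel. -/
theorem integral_coherentRep_mul_conj {r : ℝ → ℂ} (hr : IsWaveFunction r) (z w : ℂ) (K : ℤ) :
    ∫ a in (0 : ℝ)..2 * π, coherentRep z a K r * conj (coherentRep w a K r) =
      ∑' N, (‖momentumCoeff r (N - K)‖ : ℂ) ^ 2 *
        (8 * π ^ 3 * (conj (gaussMode N w) * gaussMode N z)) := by
  have h := hasSum_integral_conj_trigSeries_mul (summable_shift_mul_gaussMode hr w K)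
    (summable_shift_mul_gaussMode hr z K)
  have hf : ∀ a : ℝ, coherentRep z a K r * conj (coherentRep w a K r) =
      4 * π ^ 2 * (conj (trigSeries (fun N => momentumCoeff r (N - K) * gaussMode N w) a) *
        trigSeries (fun N => momentumCoeff r (N - K) * gaussMode N z) a) := fun a => by
    rw [coherentRep_eq_trigSeries hr, coherentRep_eq_trigSeries hr]
    simp only [map_mul, Complex.conj_ofReal, map_ofNat]
    linear_combination (4 * π ^ 2 *
      (conj (trigSeries (fun N => momentumCoeff r (N - K) * gaussMode N w) a) *
        trigSeries (fun N => momentumCoeff r (N - K) * gaussMode N z) a)) * exp_mul_conj_exp K a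
  simp only [hf, intervalIntegral.integral_const_mul]
  rw [← h.tsum_eq, ← tsum_mul_left]
  refine tsum_congr fun N => ?_
  rw [← Complex.conj_mul', map_mul]
  ring

theorem hasSum_integral_coherentRep_mul_conj {r : ℝ → ℂ} (hr : IsState r) (z w : ℂ) :
    HasSum (fun K : ℤ => ∫ a in (0 : ℝ)..2 * π, coherentRep z a K r * conj (coherentRep w a K r))
      (4 * π ^ 2 * kernel z (conj w)) := by
  simp only [integral_coherentRep_mul_conj hr.toIsWaveFunction]
  have h := (hasSum_kernel z w).mul_left (4 * π ^ 2 : ℂ)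
  have h1 : ∀ N, 4 * (π : ℂ) ^ 2 * (2 * π * (conj (gaussMode N w) * gaussMode N z)) =
      8 * π ^ 3 * (conj (gaussMode N w) * gaussMode N z) := fun N => by ring
  simp only [h1] at h
  rw [← h.tsum_eq]
  exact hasSum_tsum_sq_shift_mul hr.hasSum_sq h.summable.norm

/-! ### Expansions in coherent states -/

theorem coherentRep_mul_coeff {r q : ℝ → ℂ} (hr : IsWaveFunction r) (hq : IsWaveFunction q)
    (z : ℂ) (a : ℝ) (K : ℤ) : coherentRep z a K r * coeff q a K r = 2 * π *
      (conj (trigSeries (fun N => momentumCoeff r (N - K) * conj (momentumCoeff q N)) a) *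
        trigSeries (fun N => momentumCoeff r (N - K) * gaussMode N z) a) := by
  have h : Complex.exp (I * K * a / 2) * Complex.exp (-(I * K * a / 2)) = 1 := by
    rw [← Complex.exp_add, add_neg_cancel, Complex.exp_zero]
  rw [coherentRep_eq_trigSeries hr, coeff_eq_trigSeries hr hq, conj_trigSeries]
  simp only [map_mul, Complex.conj_conj]
  linear_combination (2 * π *
    trigSeries (fun N => momentumCoeff r (N - K) * gaussMode N z) a *
    trigSeries (fun N => conj (momentumCoeff r (N - K)) * momentumCoeff q N) (-a)) * h

theorem periodic_coherentRep_mul_coeff {r q : ℝ → ℂ} (hr : IsWaveFunction r)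
    (hq : IsWaveFunction q) (z : ℂ) (K : ℤ) :
    Function.Periodic (fun a : ℝ => coherentRep z a K r * coeff q a K r) (2 * π) := fun a => by
  simp only [coherentRep_mul_coeff hr hq, (periodic_trigSeries _) a]

theorem hasSum_integral_coherentRep_mul_coeff {r q : ℝ → ℂ} (hr : IsState r)
    (hq : IsWaveFunction q) (z : ℂ) :
    HasSum (fun K : ℤ => ∫ a in (0 : ℝ)..2 * π, coherentRep z a K r * coeff q a K r)
      (2 * π * analyticRep q z) := by
  have hr' := hr.toIsWaveFunction
  have hK : ∀ K : ℤ, ∫ a in (0 : ℝ)..2 * π, coherentRep z a K r * coeff q a K r =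
      ∑' N, (‖momentumCoeff r (N - K)‖ : ℂ) ^ 2 *
        (2 * π * (2 * π * momentumCoeff q N * gaussMode N z)) := fun K => by
    have hα : Summable fun N => ‖momentumCoeff r (N - K) * conj (momentumCoeff q N)‖ := by
      simpa only [norm_mul, RCLike.norm_conj] using summable_conj_shift_mul hr' hq K
    simp only [coherentRep_mul_coeff hr' hq, intervalIntegral.integral_const_mul]
    rw [← (hasSum_integral_conj_trigSeries_mul hα
      (summable_shift_mul_gaussMode hr' z K)).tsum_eq, ← tsum_mul_left]
    refine tsum_congr fun N => ?_
    rw [← Complex.conj_mul', map_mul, Complex.conj_conj]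
    ring
  simp only [hK]
  have h := (hasSum_analyticRep hq z).mul_left (2 * π : ℂ)
  rw [← h.tsum_eq]
  exact hasSum_tsum_sq_shift_mul hr.hasSum_sq h.summable.norm

/-- This is `hasSum_integral_coherentRep_mul_coeff` for the reflected fiducial vector, at the
reflected displacements. -/
theorem hasSum_integral_coherentRep_mul_coeffTilde {r q : ℝ → ℂ} (hr : IsState r)
    (hq : IsWaveFunction q) (z : ℂ) :
    HasSum (fun M : ℤ => ∫ b in (0 : ℝ)..2 * π, coherentRep (-z) b M r * coeffTilde q b M r)
      (2 * π * analyticRep q z) := by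
  have hr' := hr.toIsWaveFunction
  rw [← (Equiv.neg ℤ).hasSum_iff]
  convert! hasSum_integral_coherentRep_mul_coeff hr.parity hq z using 1
  funext K
  simp only [Function.comp_apply, Equiv.neg_apply, coherentRep_neg hr', coeffTilde_eq hr' hq,
    neg_neg]
  have hper := periodic_coherentRep_mul_coeff hr'.parity hq z K
  rw [intervalIntegral.integral_comp_neg
    (fun a : ℝ => coherentRep z a K (parity r) * coeff q a K (parity r)), neg_zero]
  have := hper.intervalIntegral_add_eq (-(2 * π)) 0
  rwa [neg_add_cancel, zero_add] at this

/-! ### Fourier-type transforms between the two families -/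

/-- The exponential selects the single frequency `N = M - K` of the coherent state. -/
theorem integral_coherentRep_mul_exp {r : ℝ → ℂ} (hr : IsWaveFunction r) (z : ℂ) (a : ℝ)
    (K M : ℤ) : ∫ b in (0 : ℝ)..2 * π, coherentRep z b (2 * M - K) r *
        Complex.exp (I / 2 * (-(b * K) - a * K + 2 * M * a)) =
      4 * π ^ 2 * Complex.exp (I / 2 * (-(a * K) + 2 * M * a)) *
        (momentumCoeff r (-M) * gaussMode (M - K) z) := by
  have hs := summable_shift_mul_gaussMode hr z (2 * M - K)
  have hf : ∀ b : ℝ, coherentRep z b (2 * M - K) r *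
      Complex.exp (I / 2 * (-(b * K) - a * K + 2 * M * a)) =
      2 * π * Complex.exp (I / 2 * (-(a * K) + 2 * M * a)) *
        (trigSeries (fun N => momentumCoeff r (N - (2 * M - K)) * gaussMode N z) b *
          Complex.exp (I * (M - K : ℤ) * b)) := fun b => by
    have he : Complex.exp (I * (2 * M - K : ℤ) * b / 2) *
        Complex.exp (I / 2 * (-(b * K) - a * K + 2 * M * a)) =
        Complex.exp (I / 2 * (-(a * K) + 2 * M * a)) * Complex.exp (I * (M - K : ℤ) * b) := by
      rw [← Complex.exp_add, ← Complex.exp_add]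
      congr 1
      push_cast
      ring
    rw [coherentRep_eq_trigSeries hr]
    linear_combination (2 * π *
      trigSeries (fun N => momentumCoeff r (N - (2 * M - K)) * gaussMode N z) b) * he
  simp only [hf, intervalIntegral.integral_const_mul]
  rw [integral_trigSeries_mul_exp hs, show M - K - (2 * M - K) = -M by ring]
  ring

theorem hasSum_integral_coherentRep_mul_exp {r : ℝ → ℂ} (hr : IsWaveFunction r) (z : ℂ) (a : ℝ)
    (K : ℤ) : HasSum (fun M : ℤ => ∫ b in (0 : ℝ)..2 * π, coherentRep z b (2 * M - K) r *
        Complex.exp (I / 2 * (-(b * K) - a * K + 2 * M * a)))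
      (2 * π * coherentRep (-z) a K r) := by
  simp only [integral_coherentRep_mul_exp hr]
  have h := (Equiv.subLeft K).hasSum_iff.2
    ((hasSum_coherentRep hr (-z) a K).mul_left (2 * π : ℂ))
  convert! h using 1
  funext M
  rw [Function.comp_apply, Equiv.subLeft_apply, sub_sub_cancel_left, ← neg_sub M K, gaussMode_neg]
  have he : I / 2 * (-(a * K) + 2 * M * a) =
      I * K * a / 2 - I * ((-(M - K) : ℤ) : ℂ) * a := by
    push_cast
    ring
  rw [he]
  ring

/-- The exponential selects the single frequency `N = -K` of the coefficient. -/
theorem integral_coeff_mul_exp {r q : ℝ → ℂ} (hr : IsWaveFunction r) (hq : IsWaveFunction q)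
    (b : ℝ) (M K : ℤ) : ∫ a in (0 : ℝ)..2 * π, coeff q (-a) (M - 2 * K) r *
        Complex.exp (I / 2 * (-(a * M) - b * M + 2 * K * b)) =
      2 * π * Complex.exp (I / 2 * (-(b * M) + 2 * K * b)) *
        (conj (momentumCoeff r (K - M)) * momentumCoeff q (-K)) := by
  have hs := summable_conj_shift_mul hr hq (M - 2 * K)
  have hf : ∀ a : ℝ, coeff q (-a) (M - 2 * K) r *
      Complex.exp (I / 2 * (-(a * M) - b * M + 2 * K * b)) =
      Complex.exp (I / 2 * (-(b * M) + 2 * K * b)) *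
        (trigSeries (fun N => conj (momentumCoeff r (N - (M - 2 * K))) * momentumCoeff q N) a *
          Complex.exp (I * (-K : ℤ) * a)) := fun a => by
    have he : Complex.exp (-(I * (M - 2 * K : ℤ) * (-a : ℝ) / 2)) *
        Complex.exp (I / 2 * (-(a * M) - b * M + 2 * K * b)) =
        Complex.exp (I / 2 * (-(b * M) + 2 * K * b)) * Complex.exp (I * (-K : ℤ) * a) := by
      rw [← Complex.exp_add, ← Complex.exp_add]
      congr 1
      push_cast
      ring
    rw [coeff_eq_trigSeries hr hq, neg_neg]
    linear_combination
      trigSeries (fun N => conj (momentumCoeff r (N - (M - 2 * K))) * momentumCoeff q N) a * he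
  simp only [hf, intervalIntegral.integral_const_mul]
  rw [integral_trigSeries_mul_exp hs, show -K - (M - 2 * K) = K - M by ring]
  ring

theorem hasSum_integral_coeff_mul_exp {r q : ℝ → ℂ} (hr : IsWaveFunction r)
    (hq : IsWaveFunction q) (b : ℝ) (M : ℤ) :
    HasSum (fun K : ℤ => ∫ a in (0 : ℝ)..2 * π, coeff q (-a) (M - 2 * K) r *
        Complex.exp (I / 2 * (-(a * M) - b * M + 2 * K * b)))
      (2 * π * coeffTilde q b M r) := by
  simp only [integral_coeff_mul_exp hr hq]
  rw [coeffTilde_eq hr hq]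
  have h := (Equiv.neg ℤ).hasSum_iff.2
    ((hasSum_coeff hr.parity hq (-b) (-M)).mul_left (2 * π : ℂ))
  convert! h using 1
  funext K
  rw [Function.comp_apply, Equiv.neg_apply, momentumCoeff_displacement hr.parity.periodic,
    momentumCoeff_parity hr.periodic, map_mul, ← Complex.exp_conj,
    show -(-K - -M) = K - M by ring]
  have he : conj (I * ((-M : ℤ) : ℂ) * ((-b : ℝ) : ℂ) / 2 - I * ((-K : ℤ) : ℂ) * ((-b : ℝ) : ℂ)) =
      I / 2 * (-(b * M) + 2 * K * b) := by
    simp only [map_sub, map_div₀, map_mul, Complex.conj_I, Complex.conj_ofReal, map_intCast,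
      map_ofNat]
    push_cast
    ring
  rw [he]
  ring

theorem integral_coherentRep {r : ℝ → ℂ} (hr : IsWaveFunction r) (z : ℂ) (K : ℤ) :
    ∫ a in (0 : ℝ)..2 * π, coherentRep z a (-2 * K) r =
      4 * (π : ℂ) ^ 2 * momentumCoeff r K * Complex.exp (-(I * z * K) - 1 / 2 * (K : ℂ) ^ 2) := by
  -- For vanishing `a` and `K` the exponential factor of the transform is `1`.
  have h := integral_coherentRep_mul_exp hr z 0 0 (-K)
  have hK : 2 * -K - 0 = -2 * K := by ring
  have h1 : ∀ b : ℝ, Complex.exp (I / 2 * (-(b * (0 : ℤ)) - (0 : ℝ) * (0 : ℤ) +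
      2 * (-K : ℤ) * (0 : ℝ))) = 1 := fun b => by simp
  simp only [h1, mul_one, hK] at h
  rw [h, gaussMode, neg_neg, sub_zero]
  have h2 : I * ((-K : ℤ) : ℂ) * z - ((-K : ℤ) : ℂ) ^ 2 / 2 =
      -(I * z * K) - 1 / 2 * (K : ℂ) ^ 2 := by
    push_cast
    ring
  rw [h2]
  simp
  ring

/-! ### Gaussian integrals over the strip -/

theorem measurableSet_strip : MeasurableSet strip :=
  (measurableSet_le measurable_const Complex.measurable_re).inter
    (measurableSet_le Complex.measurable_re measurable_const)

/-- Lebesgue measure on the strip is the product of the measures in the two real coordinates. -/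
theorem measurePreserving_strip : MeasurePreserving Complex.measurableEquivRealProd
    (volume.restrict strip) ((volume.restrict (Icc 0 (2 * π))).prod volume) := by
  have h := Complex.volume_preserving_equiv_real_prod.restrict_preimage_emb
    Complex.measurableEquivRealProd.measurableEmbedding (Icc (0 : ℝ) (2 * π) ×ˢ (univ : Set ℝ))
  have hpre : Complex.measurableEquivRealProd ⁻¹' (Icc (0 : ℝ) (2 * π) ×ˢ (univ : Set ℝ)) =
      strip := by
    ext w
    simp [strip, Complex.measurableEquivRealProd_apply]
  rw [hpre, Measure.volume_eq_prod, ← Measure.prod_restrict, Measure.restrict_univ] at h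
  exact h

theorem dm_restrict_strip : dm.restrict strip = (volume.restrict strip).withDensity fun z =>
    ENNReal.ofReal (1 / (4 * π ^ (5 / 2 : ℝ)) * Real.exp (-z.im ^ 2)) :=
  restrict_withDensity measurableSet_strip _

theorem integral_exp_neg_mul_gaussian (s : ℝ) :
    ∫ y : ℝ, Complex.exp (-(s * y)) * Complex.exp (-(y : ℂ) ^ 2) =
      (π : ℂ) ^ (1 / 2 : ℂ) * Complex.exp ((s : ℂ) ^ 2 / 4) := by
  have h := integral_cexp_quadratic (b := -1) (by norm_num) (-s) 0
  have h1 : ∀ y : ℝ, Complex.exp (-1 * (y : ℂ) ^ 2 + -s * y + 0) =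
      Complex.exp (-(s * y)) * Complex.exp (-(y : ℂ) ^ 2) := fun y => by
    rw [← Complex.exp_add]; ring_nf
  simp only [h1] at h
  rw [h]
  congr 2
  · simp
  · ring

theorem integrable_exp_neg_mul_gaussian (s : ℝ) :
    Integrable fun y : ℝ => Complex.exp (-(s * y)) * Complex.exp (-(y : ℂ) ^ 2) := by
  refine (integrable_cexp_quadratic' (b := -1) (by norm_num) (-s) 0).congr (.of_forall fun y => ?_)
  simp only []
  rw [← Complex.exp_add]
  ring_nf

/-- The normalisation of `dm`, the length of the period and the Gaussian integral combine to
`1/(2π)`. -/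
theorem dm_const : 1 / (4 * (π : ℂ) ^ ((5 / 2 : ℝ) : ℂ)) * (2 * π) * (π : ℂ) ^ (1 / 2 : ℂ) =
    1 / (2 * π) := by
  have h0 : (π : ℂ) ≠ 0 := by exact_mod_cast Real.pi_ne_zero
  have h1 : (π : ℂ) ^ ((5 / 2 : ℝ) : ℂ) = (π : ℂ) ^ 2 * (π : ℂ) ^ (1 / 2 : ℂ) := by
    rw [← Complex.cpow_natCast, ← Complex.cpow_add _ _ h0]
    congr 1
    push_cast
    norm_num
  have h2 : (π : ℂ) ^ (1 / 2 : ℂ) ≠ 0 := by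
    rw [Ne, Complex.cpow_eq_zero_iff]
    exact fun h => h0 h.1
  rw [h1]
  field_simp
  norm_num

theorem integral_strip_exp (k : ℤ) (s : ℝ) :
    Integrable (fun w : ℂ => Complex.exp (I * k * w.re) * Complex.exp (-(s * w.im)))
      (dm.restrict strip) ∧
    ∫ w in strip, Complex.exp (I * k * w.re) * Complex.exp (-(s * w.im)) ∂dm =
      (if k = 0 then 1 / (2 * π) else 0 : ℂ) * Complex.exp ((s : ℂ) ^ 2 / 4) := by
  have hmeas : Measurable fun z : ℂ =>
      ENNReal.ofReal (1 / (4 * π ^ (5 / 2 : ℝ)) * Real.exp (-z.im ^ 2)) := by fun_prop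
  have hfin : ∀ᵐ z ∂(volume.restrict strip),
      ENNReal.ofReal (1 / (4 * π ^ (5 / 2 : ℝ)) * Real.exp (-z.im ^ 2)) < ⊤ :=
    .of_forall fun _ => ENNReal.ofReal_lt_top
  set G : ℝ × ℝ → ℂ := fun p => (1 / (4 * (π : ℂ) ^ ((5 / 2 : ℝ) : ℂ)) *
    Complex.exp (I * k * p.1)) * (Complex.exp (-(s * p.2)) * Complex.exp (-(p.2 : ℂ) ^ 2)) with hG
  have hfun : (fun w : ℂ =>
      (ENNReal.ofReal (1 / (4 * π ^ (5 / 2 : ℝ)) * Real.exp (-w.im ^ 2))).toReal •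
        (Complex.exp (I * k * w.re) * Complex.exp (-(s * w.im)))) =
      G ∘ Complex.measurableEquivRealProd := by
    funext w
    rw [ENNReal.toReal_ofReal (by positivity), Function.comp_apply,
      Complex.measurableEquivRealProd_apply, hG, Complex.real_smul]
    push_cast
    rw [Complex.ofReal_cpow Real.pi_pos.le]
    push_cast
    ring
  have hmp := measurePreserving_strip
  have hemb := Complex.measurableEquivRealProd.measurableEmbedding
  have hint1 : Integrable (fun x : ℝ => 1 / (4 * (π : ℂ) ^ ((5 / 2 : ℝ) : ℂ)) *
      Complex.exp (I * k * x)) (volume.restrict (Icc 0 (2 * π))) :=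
    (Continuous.continuousOn (by fun_prop)).integrableOn_Icc
  constructor
  · rw [dm_restrict_strip, integrable_withDensity_iff_integrable_smul' hmeas hfin, hfun,
      hmp.integrable_comp_emb hemb]
    exact hint1.mul_prod (integrable_exp_neg_mul_gaussian s)
  · rw [dm_restrict_strip, integral_withDensity_eq_integral_toReal_smul hmeas hfin, hfun]
    have h := hmp.integral_comp hemb G
    simp only [Function.comp_def]
    rw [h, hG, integral_prod_mul (fun x : ℝ => 1 / (4 * (π : ℂ) ^ ((5 / 2 : ℝ) : ℂ)) *
      Complex.exp (I * k * x)) fun y : ℝ => Complex.exp (-(s * y)) * Complex.exp (-(y : ℂ) ^ 2),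
      integral_exp_neg_mul_gaussian, integral_const_mul, integral_Icc_eq_integral_Ioc,
      ← intervalIntegral.integral_of_le Real.two_pi_pos.le, integral_exp_int, ← mul_assoc]
    congr 1
    split_ifs
    · exact dm_const
    · simp

theorem conj_gaussMode_mul_gaussMode (N M : ℤ) (w : ℂ) :
    conj (gaussMode N w) * gaussMode M w =
      Complex.exp (-((N : ℂ) ^ 2 + (M : ℂ) ^ 2) / 2) *
        (Complex.exp (I * (M - N : ℤ) * w.re) * Complex.exp (-((N + M : ℝ) * w.im))) := by
  have hw : conj w = w.re - w.im * I := by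
    apply Complex.ext <;> simp
  rw [conj_gaussMode, gaussMode, gaussMode, ← Complex.exp_add, ← Complex.exp_add,
    ← Complex.exp_add, hw]
  congr 1
  nth_rw 3 [← Complex.re_add_im w]
  push_cast
  linear_combination ((N + M : ℂ) * w.im) * Complex.I_sq

theorem integrable_conj_gaussMode_mul (N M : ℤ) :
    Integrable (fun w => conj (gaussMode N w) * gaussMode M w) (dm.restrict strip) := by
  simp only [conj_gaussMode_mul_gaussMode]
  exact (integral_strip_exp (M - N) (N + M)).1.const_mul _

/-- The Gaussian modes are orthogonal in `L²(A, dm)`, with norm squared `1/(2π)`. -/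
theorem integral_conj_gaussMode_mul (N M : ℤ) :
    ∫ w in strip, conj (gaussMode N w) * gaussMode M w ∂dm =
      (if M = N then 1 / (2 * π) else 0 : ℂ) := by
  simp only [conj_gaussMode_mul_gaussMode]
  rw [integral_const_mul, (integral_strip_exp (M - N) (N + M)).2]
  rcases eq_or_ne M N with rfl | h
  · rw [sub_self, if_pos rfl, if_pos rfl, mul_left_comm, ← Complex.exp_add]
    have : -((M : ℂ) ^ 2 + (M : ℂ) ^ 2) / 2 + ((M + M : ℝ) : ℂ) ^ 2 / 4 = 0 := by
      push_cast; ring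
    rw [this, Complex.exp_zero, mul_one]
  · rw [if_neg (sub_ne_zero.2 h), if_neg h, zero_mul, mul_zero]

/-- Although the modes grow along the strip, the products decay in `N - M`: this is what makes the
double series for a scalar product of two analytic representations converge absolutely. -/
theorem integral_norm_conj_gaussMode_mul (N M : ℤ) :
    ∫ w in strip, ‖conj (gaussMode N w) * gaussMode M w‖ ∂dm =
      1 / (2 * π) * Real.exp (-(1 / 4) * ((N - M : ℤ) : ℝ) ^ 2) := by
  have h1 : ∀ w : ℂ, ((‖conj (gaussMode N w) * gaussMode M w‖ : ℝ) : ℂ) =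
      Complex.exp (-((N : ℂ) ^ 2 + (M : ℂ) ^ 2) / 2) *
        (Complex.exp (I * (0 : ℤ) * w.re) * Complex.exp (-((N + M : ℝ) * w.im))) := fun w => by
    rw [norm_mul, RCLike.norm_conj, norm_gaussMode, norm_gaussMode, ← Real.exp_add,
      Complex.ofReal_exp, ← Complex.exp_add, ← Complex.exp_add]
    congr 1
    push_cast
    ring
  rw [← Complex.ofReal_inj, ← integral_complex_ofReal]
  simp only [h1]
  rw [integral_const_mul, (integral_strip_exp 0 (N + M)).2, if_pos rfl, mul_left_comm,
    ← Complex.exp_add]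
  push_cast
  congr 2
  ring

/-- A pointwise convergent series of integrable functions with summable `L¹` norms has an integrable
sum. -/
theorem integrable_of_hasSum {ι X : Type*} [Countable ι] [MeasurableSpace X] {μ : Measure X}
    {F : ι → X → ℂ} {f : X → ℂ} (hF : ∀ i, Integrable (F i) μ)
    (hs : Summable fun i => ∫ x, ‖F i x‖ ∂μ) (hf : ∀ x, HasSum (fun i => F i x) (f x)) :
    Integrable f μ := by
  refine ⟨?_, ?_⟩
  · refine aestronglyMeasurable_of_tendsto_ae (u := (atTop : Filter (Finset ι)))
      (f := fun s x => ∑ i ∈ s, F i x) ?_ (.of_forall fun x => hf x)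
    intro s
    exact Finset.aestronglyMeasurable_fun_sum s fun i _ => (hF i).1
  · rw [hasFiniteIntegral_iff_enorm]
    calc ∫⁻ x, ‖f x‖ₑ ∂μ ≤ ∫⁻ x, ∑' i, ‖F i x‖ₑ ∂μ :=
          lintegral_mono fun x => by rw [← (hf x).tsum_eq]; exact enorm_tsum_le_tsum_enorm
      _ = ∑' i, ∫⁻ x, ‖F i x‖ₑ ∂μ := lintegral_tsum fun i => (hF i).1.enorm
      _ = ∑' i, ENNReal.ofReal (∫ x, ‖F i x‖ ∂μ) := by
          simp only [ofReal_integral_norm_eq_lintegral_enorm (hF _)]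
      _ < ⊤ := by
          rw [← ENNReal.ofReal_tsum_of_nonneg (fun i => integral_nonneg fun x => norm_nonneg _) hs]
          exact ENNReal.ofReal_lt_top

/-- A form of Young's inequality: a summable convolution kernel pairs two `ℓ²` sequences to an
absolutely convergent double series. -/
theorem summable_mul_mul_sub {a b g : ℤ → ℝ} (ha : ∀ N, 0 ≤ a N) (hb : ∀ N, 0 ≤ b N)
    (hg : ∀ N, 0 ≤ g N) (ha2 : Summable fun N => a N ^ 2) (hb2 : Summable fun N => b N ^ 2)
    (hgs : Summable g) : Summable fun p : ℤ × ℤ => a p.1 * b p.2 * g (p.1 - p.2) := by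
  let e : ℤ × ℤ ≃ ℤ × ℤ :=
    { toFun := fun p => (p.1, p.1 - p.2)
      invFun := fun p => (p.1, p.1 - p.2)
      left_inv := fun p => by simp
      right_inv := fun p => by simp }
  let e' : ℤ × ℤ ≃ ℤ × ℤ :=
    { toFun := fun p => (p.2, p.1 - p.2)
      invFun := fun p => (p.1 + p.2, p.1)
      left_inv := fun p => by simp
      right_inv := fun p => by simp }
  have h1 := e.summable_iff.2 (ha2.mul_of_nonneg hgs (fun N => sq_nonneg _) hg)
  have h2 := e'.summable_iff.2 (hb2.mul_of_nonneg hgs (fun N => sq_nonneg _) hg)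
  refine .of_nonneg_of_le (fun p => mul_nonneg (mul_nonneg (ha _) (hb _)) (hg _)) (fun p => ?_)
    (h1.add h2)
  have hab : a p.1 * b p.2 ≤ a p.1 ^ 2 + b p.2 ^ 2 := by
    nlinarith [sq_nonneg (a p.1 - b p.2), sq_nonneg (a p.1), sq_nonneg (b p.2)]
  have := mul_le_mul_of_nonneg_right hab (hg (p.1 - p.2))
  rw [add_mul] at this
  exact this

/-! ### The scalar product of analytic representations -/

/-- The scalar product in `L²(A, dm)` of two series of Gaussian modes with square-summable
coefficients. -/
theorem integral_strip_conj_mul {α β : ℤ → ℂ} {f g : ℂ → ℂ}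
    (hα : Summable fun N => ‖α N‖ ^ 2) (hβ : Summable fun N => ‖β N‖ ^ 2)
    (hf : ∀ w, HasSum (fun N => α N * gaussMode N w) (f w))
    (hg : ∀ w, HasSum (fun N => β N * gaussMode N w) (g w)) :
    IntegrableOn (fun w => conj (f w) * g w) strip dm ∧
      HasSum (fun N => 1 / (2 * π) * (conj (α N) * β N)) (∫ w in strip, conj (f w) * g w ∂dm) := by
  set F : ℤ × ℤ → ℂ → ℂ := fun p w =>
    (conj (α p.1) * β p.2) * (conj (gaussMode p.1 w) * gaussMode p.2 w) with hFdef
  have hF : ∀ p, Integrable (F p) (dm.restrict strip) := fun p =>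
    (integrable_conj_gaussMode_mul p.1 p.2).const_mul _
  have hnorm : ∀ p, ∫ w in strip, ‖F p w‖ ∂dm = 1 / (2 * π) * (‖α p.1‖ * ‖β p.2‖ *
      Real.exp (-(1 / 4) * ((p.1 - p.2 : ℤ) : ℝ) ^ 2)) := fun p => by
    simp only [hFdef, norm_mul (conj (α p.1) * β p.2), integral_const_mul,
      integral_norm_conj_gaussMode_mul]
    rw [norm_mul, RCLike.norm_conj]
    ring
  have hgauss : Summable fun N : ℤ => Real.exp (-(1 / 4) * (N : ℝ) ^ 2) := by
    simpa using summable_abs_pow_mul_exp (1 / 4) (by norm_num) 0 0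
  have hsum : Summable fun p => ∫ w in strip, ‖F p w‖ ∂dm := by
    simp only [hnorm]
    exact (summable_mul_mul_sub (fun _ => norm_nonneg _) (fun _ => norm_nonneg _)
      (fun _ => (Real.exp_pos _).le) hα hβ hgauss).mul_left _
  have hlim : ∀ w, HasSum (fun p => F p w) (conj (f w) * g w) := fun w => by
    have h1 : HasSum (fun N => conj (α N * gaussMode N w)) (conj (f w)) := by
      exact (Complex.hasSum_conj' ).2 (hf w)
    have hs := (summable_mul_of_summable_norm h1.summable.norm (hg w).summable.norm)
    convert! h1.mul (hg w) hs using 1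
    funext p
    simp only [hFdef, map_mul]
    ring
  have hint := integrable_of_hasSum hF hsum hlim
  refine ⟨hint, ?_⟩
  have key := hasSum_integral_of_summable_integral_norm hF hsum
  simp only [(hlim _).tsum_eq] at key
  have hval : ∀ p : ℤ × ℤ, ∫ w in strip, F p w ∂dm =
      (if p.2 = p.1 then 1 / (2 * π) * (conj (α p.1) * β p.1) else 0 : ℂ) := fun p => by
    simp only [hFdef, integral_const_mul, integral_conj_gaussMode_mul]
    split_ifs with h
    · rw [h, mul_comm]
    · rw [mul_zero]
  simp only [hval] at key
  exact key.prod_fiberwise fun N => hasSum_ite_eq N _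

/-- Up to the factor `2π`, the analytic representation is an isometry into `L²(A, dm)`. -/
theorem integral_strip_conj_analyticRep_mul {p q : ℝ → ℂ} (hp : IsWaveFunction p)
    (hq : IsWaveFunction q) :
    IntegrableOn (fun w => conj (analyticRep p w) * analyticRep q w) strip dm ∧
      ∫ w in strip, conj (analyticRep p w) * analyticRep q w ∂dm = 2 * π * braket p q := by
  have hs : ∀ {q : ℝ → ℂ}, IsWaveFunction q →
      Summable fun N => ‖2 * π * momentumCoeff q N‖ ^ 2 := fun hq => by
    simp only [norm_mul, mul_pow]
    exact hq.summable_sq.mul_left _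
  obtain ⟨h1, h2⟩ := integral_strip_conj_mul (hs hp) (hs hq) (hasSum_analyticRep hp)
    (hasSum_analyticRep hq)
  refine ⟨h1, h2.unique ?_⟩
  convert! (hasSum_braket hp hq).mul_left (2 * π : ℂ) using 1
  funext N
  have hpi : (π : ℂ) ≠ 0 := by exact_mod_cast Real.pi_ne_zero
  simp only [map_mul, Complex.conj_ofReal, map_ofNat]
  field_simp

/-- The coefficient `⟨D(a,K)r|q⟩` as a scalar product of analytic representations. -/
theorem integral_strip_conj_coherentRep_mul {r q : ℝ → ℂ} (hr : IsWaveFunction r)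
    (hq : IsWaveFunction q) (a : ℝ) (K : ℤ) :
    IntegrableOn (fun w => conj (coherentRep w a K r) * analyticRep q w) strip dm ∧
      coeff q a K r =
        1 / (2 * π) * ∫ w in strip, conj (coherentRep w a K r) * analyticRep q w ∂dm := by
  obtain ⟨h1, h2⟩ := integral_strip_conj_analyticRep_mul (hr.displacement a K) hq
  refine ⟨h1, ?_⟩
  have hpi : (π : ℂ) ≠ 0 := by exact_mod_cast Real.pi_ne_zero
  have h3 : coeff q a K r = braket (displacement a K r) q :=
    (hasSum_coeff hr hq a K).unique (hasSum_braket (hr.displacement a K) hq)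
  simp only [coherentRep]
  rw [h2, h3]
  field_simp

theorem reproducing_kernel {q : ℝ → ℂ} (hq : IsWaveFunction q) (z : ℂ) :
    IntegrableOn (fun w => kernel z (conj w) * analyticRep q w) strip dm ∧
      analyticRep q z = ∫ w in strip, kernel z (conj w) * analyticRep q w ∂dm := by
  -- As a function of `w`, the conjugate of the kernel is a series of Gaussian modes.
  have hk : ∀ w, HasSum (fun N => 2 * π * conj (gaussMode N z) * gaussMode N w)
      (conj (kernel z (conj w))) := fun w => by
    convert! (Complex.hasSum_conj').2 (hasSum_kernel z w) using 1
    funext N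
    simp only [map_mul, Complex.conj_ofReal, map_ofNat, Complex.conj_conj]
    ring
  have hα : Summable fun N => ‖2 * π * conj (gaussMode N z)‖ ^ 2 := by
    simp only [norm_mul, mul_pow, RCLike.norm_conj]
    refine Summable.mul_left _ ?_
    have := summable_norm_mul_gaussMode (α := fun N => gaussMode N z)
      (fun N => (summable_norm_gaussMode z).le_tsum N fun _ _ => norm_nonneg _) z
    simpa only [← pow_two, norm_pow] using this
  have hβ : Summable fun N => ‖2 * π * momentumCoeff q N‖ ^ 2 := by
    simp only [norm_mul, mul_pow]
    exact hq.summable_sq.mul_left _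
  obtain ⟨h1, h2⟩ := integral_strip_conj_mul hα hβ hk (hasSum_analyticRep hq)
  simp only [Complex.conj_conj] at h1 h2
  refine ⟨h1, (hasSum_analyticRep hq z).unique ?_⟩
  convert! h2 using 1
  funext N
  have hpi : (π : ℂ) ≠ 0 := by exact_mod_cast Real.pi_ne_zero
  simp only [map_mul, Complex.conj_ofReal, map_ofNat, Complex.conj_conj]
  field_simp

/-! ### Sums of coherent states over the momentum parameter -/

/-- The partial sum over `K ∈ s` of the Fourier series of `r` at the frequencies `N - K`. -/
noncomputable def shiftedPartialSum (r : ℝ → ℂ) (s : Finset ℤ) (N : ℤ) (x : ℝ) : ℂ :=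
  ∑ K ∈ s, momentumCoeff r (N - K) * Complex.exp (I * (N - K : ℤ) * x)

/-- Grouping the double series of `∑_{K ∈ s} 𝔡(z; a, K; r)` by `N` gives partial Fourier sums of `r`
at `-a/2`, weighted by the terms of a theta series. -/
theorem hasSum_sum_coherentRep {r : ℝ → ℂ} (hr : IsWaveFunction r) (z : ℂ) (a : ℝ)
    (s : Finset ℤ) :
    HasSum (fun N : ℤ => 2 * π * (Complex.exp (I * N * (-(1 / 2) * a : ℝ)) * gaussMode N z) *
      shiftedPartialSum r s N (-(1 / 2) * a)) (∑ K ∈ s, coherentRep z a K r) := by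
  have h := hasSum_sum (s := s) fun K _ => hasSum_coherentRep hr z a K
  convert! h using 1
  funext N
  rw [shiftedPartialSum, Finset.mul_sum]
  refine Finset.sum_congr rfl fun K _ => ?_
  have he : Complex.exp (I * K * a / 2 - I * N * a) =
      Complex.exp (I * N * (-(1 / 2) * a : ℝ)) *
        Complex.exp (I * (N - K : ℤ) * (-(1 / 2) * a : ℝ)) := by
    rw [← Complex.exp_add]
    congr 1
    push_cast
    ring
  rw [he]
  ring

theorem hasSum_theta3_marginal (z : ℂ) (a : ℝ) (c : ℂ) :
    HasSum (fun N : ℤ => 2 * π * (Complex.exp (I * N * (-(1 / 2) * a : ℝ)) * gaussMode N z) * c)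
      (2 * π * c * theta3 ((a - 2 * z) / 4) (I / (2 * π))) := by
  convert! (hasSum_theta3 ((a - 2 * z) / 4)).mul_left (2 * π * c) using 1
  funext N
  have he : Complex.exp (I * N * (-(1 / 2) * a : ℝ)) * gaussMode N z =
      Complex.exp (-(I * 2 * N * ((a - 2 * z) / 4)) - (N : ℂ) ^ 2 / 2) := by
    rw [gaussMode, ← Complex.exp_add]
    congr 1
    push_cast
    ring
  rw [he]
  ring

theorem norm_marginal_weight (z : ℂ) (x : ℝ) (N : ℤ) :
    ‖2 * π * (Complex.exp (I * N * x) * gaussMode N z)‖ = 2 * π * ‖gaussMode N z‖ := by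
  rw [norm_mul, norm_mul, norm_mul, norm_exp_I_int, one_mul, Complex.norm_real,
    Real.norm_of_nonneg Real.pi_pos.le, Complex.norm_two]

/-! ### Pointwise convergence along symmetric partial sums -/

theorem norm_sub_zero_le_of_step {E : Type*} [SeminormedAddCommGroup E] {h : ℤ → E} {D : ℝ}
    (hD : ∀ N, ‖h (N + 1) - h N‖ ≤ D) (N : ℤ) : ‖h N - h 0‖ ≤ D * |(N : ℝ)| := by
  induction N using Int.induction_on with
  | zero => simp
  | succ n ih =>
    have := norm_sub_le_norm_sub_add_norm_sub (h (n + 1)) (h n) (h 0)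
    have h1 := hD n
    push_cast at *
    rw [abs_of_nonneg (by positivity)] at *
    linarith
  | pred n ih =>
    have := norm_sub_le_norm_sub_add_norm_sub (h (-n - 1)) (h (-n)) (h 0)
    have h1 := hD (-n - 1)
    rw [sub_add_cancel, norm_sub_rev] at h1
    push_cast at *
    rw [show (-(n : ℝ) - 1) = -(n + 1) by ring, abs_neg, abs_of_nonneg (by positivity)]
    rw [abs_neg, abs_of_nonneg (by positivity)] at ih
    linarith

/-- Moving a symmetric window by one step changes the sum by its two boundary terms. -/
theorem sum_Icc_shift_sub {E : Type*} [AddCommGroup E] (f : ℤ → E) (N : ℤ) (n : ℕ) :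
    ∑ K ∈ Finset.Icc (-(n : ℤ)) n, f (N + 1 - K) - ∑ K ∈ Finset.Icc (-(n : ℤ)) n, f (N - K) =
      f (N + 1 + n) - f (N - n) := by
  rw [← Finset.sum_sub_distrib]
  induction n with
  | zero => simp
  | succ n ih =>
    have hI : Finset.Icc (-((n + 1 : ℕ) : ℤ)) (n + 1 : ℕ) =
        insert (-((n : ℤ) + 1)) (insert ((n : ℤ) + 1) (Finset.Icc (-(n : ℤ)) n)) := by
      ext k
      simp only [Finset.mem_insert, Finset.mem_Icc]
      push_cast
      omega
    rw [hI, Finset.sum_insert, Finset.sum_insert, ih]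
    · push_cast
      rw [show N + 1 - -((n : ℤ) + 1) = N + 1 + (n + 1) by ring,
        show N - -((n : ℤ) + 1) = N + 1 + n by ring, show N + 1 - ((n : ℤ) + 1) = N - n by ring]
      abel
    · simp
    · simp only [Finset.mem_insert, Finset.mem_Icc]
      omega

/-- Shifting the window by a fixed `N` does not change the limit, since the Fourier coefficients
tend to zero. -/
theorem tendsto_shiftedPartialSum {r : ℝ → ℂ} (hr : IsWaveFunction r) {x : ℝ} {L : ℂ}
    (h : Tendsto (fun n : ℕ => shiftedPartialSum r (Finset.Icc (-(n : ℤ)) n) 0 x) atTop (𝓝 L))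
    (N : ℤ) :
    Tendsto (fun n : ℕ => shiftedPartialSum r (Finset.Icc (-(n : ℤ)) n) N x) atTop (𝓝 L) := by
  set f : ℤ → ℂ := fun m => momentumCoeff r m * Complex.exp (I * m * x) with hf
  have hf0 : Tendsto f cofinite (𝓝 0) := by
    rw [tendsto_zero_iff_norm_tendsto_zero]
    have h2 := (hr.summable_sq.tendsto_cofinite_zero).sqrt
    simpa only [Real.sqrt_sq (norm_nonneg _), Real.sqrt_zero, hf, norm_mul, norm_exp_I_int,
      mul_one] using h2
  have hstep : ∀ N : ℤ, Tendsto (fun n : ℕ =>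
      shiftedPartialSum r (Finset.Icc (-(n : ℤ)) n) (N + 1) x -
        shiftedPartialSum r (Finset.Icc (-(n : ℤ)) n) N x) atTop (𝓝 0) := fun N => by
    have h1 : Tendsto (fun n : ℕ => f (N + 1 + n)) atTop (𝓝 0) := by
      have hinj : Function.Injective fun n : ℕ => N + 1 + (n : ℤ) := fun a b hab => by simpa using hab
      exact hf0.comp (Nat.cofinite_eq_atTop ▸ hinj.tendsto_cofinite)
    have h2 : Tendsto (fun n : ℕ => f (N - n)) atTop (𝓝 0) := by
      have hinj : Function.Injective fun n : ℕ => N - (n : ℤ) := fun a b hab => by simpa using hab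
      exact hf0.comp (Nat.cofinite_eq_atTop ▸ hinj.tendsto_cofinite)
    have h3 := h1.sub h2
    rw [sub_zero] at h3
    exact h3.congr fun n => (sum_Icc_shift_sub f N n).symm
  induction N using Int.induction_on with
  | zero => exact h
  | succ n ih => simpa using (hstep n).add ih
  | pred n ih =>
    have := ih.sub (hstep (-n - 1))
    simpa using this

theorem shiftedPartialSum_symm_zero (r : ℝ → ℂ) (n : ℕ) (x : ℝ) :
    shiftedPartialSum r (Finset.Icc (-(n : ℤ)) n) 0 x =
      ∑ N ∈ Finset.Icc (-(n : ℤ)) n, momentumCoeff r N * Complex.exp (I * N * x) := by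
  refine Finset.sum_nbij' (fun K => -K) (fun K => -K) ?_ ?_ ?_ ?_ ?_
  · intro K hK; rw [Finset.mem_Icc] at *; omega
  · intro K hK; rw [Finset.mem_Icc] at *; omega
  · intro K _; simp
  · intro K _; simp
  · intro K _; simp

theorem tendsto_sum_coherentRep {r : ℝ → ℂ} (hr : IsWaveFunction r) (z : ℂ) (a : ℝ) {L : ℂ}
    (h : Tendsto (fun n : ℕ => ∑ N ∈ Finset.Icc (-(n : ℤ)) n,
      momentumCoeff r N * Complex.exp (I * N * (-(1 / 2) * a : ℝ))) atTop (𝓝 L)) :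
    Tendsto (fun n : ℕ => ∑ K ∈ Finset.Icc (-(n : ℤ)) n, coherentRep z a K r) atTop
      (𝓝 (2 * π * L * theta3 ((a - 2 * z) / 4) (I / (2 * π)))) := by
  set x : ℝ := -(1 / 2) * a with hx
  simp only [← shiftedPartialSum_symm_zero] at h
  obtain ⟨C, hC⟩ := hr.exists_momentumCoeff_le
  obtain ⟨B, hB⟩ := (Metric.isBounded_range_of_tendsto _ h).exists_norm_le
  -- Each unit shift of the window costs at most `2C`; linear growth in `N` is harmless against the
  -- Gaussian weights.
  have hbound : ∀ (n : ℕ) (N : ℤ), ‖shiftedPartialSum r (Finset.Icc (-(n : ℤ)) n) N x‖ ≤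
      B + 2 * C * |(N : ℝ)| := fun n N => by
    have h1 := norm_sub_zero_le_of_step (D := 2 * C)
      (h := fun N => shiftedPartialSum r (Finset.Icc (-(n : ℤ)) n) N x) (fun N => ?_) N
    · have h2 := hB _ ⟨n, rfl⟩
      have h3 := norm_le_norm_add_norm_sub (shiftedPartialSum r (Finset.Icc (-(n : ℤ)) n) 0 x)
        (shiftedPartialSum r (Finset.Icc (-(n : ℤ)) n) N x)
      rw [norm_sub_rev] at h3
      linarith
    · have h4 := sum_Icc_shift_sub
        (fun m : ℤ => momentumCoeff r m * Complex.exp (I * m * x)) N n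
      refine (congrArg norm h4).trans_le ((norm_sub_le _ _).trans ?_)
      rw [norm_mul, norm_mul, norm_exp_I_int, norm_exp_I_int, mul_one, mul_one]
      linarith [hC (N + 1 + n), hC (N - n)]
  simp only [← (hasSum_sum_coherentRep hr z a _).tsum_eq,
    ← (hasSum_theta3_marginal z a L).tsum_eq]
  have hsummable : Summable fun N : ℤ => 2 * π * ‖gaussMode N z‖ * (B + 2 * C * |(N : ℝ)|) := by
    refine (((summable_norm_gaussMode z).mul_left (2 * π * B)).add
      ((summable_abs_mul_norm_gaussMode z).mul_left (2 * π * (2 * C)))).congr fun N => ?_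
    ring
  have key := tendsto_tsum_of_dominated_convergence (𝓕 := atTop) hsummable
    (f := fun (n : ℕ) (N : ℤ) => 2 * π * (Complex.exp (I * N * x) * gaussMode N z) *
      shiftedPartialSum r (Finset.Icc (-(n : ℤ)) n) N x)
    (g := fun N : ℤ => 2 * π * (Complex.exp (I * N * x) * gaussMode N z) * L)
    (fun N => (tendsto_shiftedPartialSum hr h N).const_mul _)
    (.of_forall fun n N => by
      rw [norm_mul, norm_marginal_weight]
      exact mul_le_mul_of_nonneg_left (hbound n N) (by positivity))
  exact key

/-! ### Convergence in mean square -/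

/-- A weighted Cauchy–Schwarz inequality, with a superfluous constant `2`, free of summability
hypotheses. -/
theorem ennreal_sq_tsum_mul_le {ι : Type*} (w d : ι → ENNReal) :
    (∑' i, w i * d i) ^ 2 ≤ 2 * (∑' i, w i) * ∑' i, w i * d i ^ 2 := by
  have hxy : ∀ x y : ENNReal, x * y ≤ x ^ 2 + y ^ 2 := fun x y => by
    rcases le_total x y with h | h
    · exact (mul_le_mul_left h y).trans (by rw [← sq]; exact le_add_self)
    · exact (mul_le_mul_right h x).trans (by rw [← sq]; exact le_self_add)
  have h1 : (∑' i, w i * d i) ^ 2 = ∑' i, ∑' j, w i * w j * (d i * d j) := by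
    rw [sq, ← ENNReal.tsum_mul_right]
    refine tsum_congr fun i => ?_
    rw [← ENNReal.tsum_mul_left]
    refine tsum_congr fun j => ?_
    ring
  have h2 : ∀ i, ∑' j, w i * w j * d i ^ 2 = w i * d i ^ 2 * ∑' j, w j := fun i => by
    rw [← ENNReal.tsum_mul_left]
    exact tsum_congr fun j => by ring
  have h3 : ∀ i, ∑' j, w i * w j * d j ^ 2 = w i * ∑' j, w j * d j ^ 2 := fun i => by
    rw [← ENNReal.tsum_mul_left]
    exact tsum_congr fun j => by ring
  calc (∑' i, w i * d i) ^ 2 = ∑' i, ∑' j, w i * w j * (d i * d j) := h1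
    _ ≤ ∑' i, ∑' j, (w i * w j * d i ^ 2 + w i * w j * d j ^ 2) := by
        refine ENNReal.tsum_le_tsum fun i => ENNReal.tsum_le_tsum fun j => ?_
        rw [← mul_add]
        gcongr
        exact hxy _ _
    _ = 2 * (∑' i, w i) * ∑' i, w i * d i ^ 2 := by
        simp only [ENNReal.tsum_add, h2, h3, ENNReal.tsum_mul_right]
        ring

theorem IsWaveFunction.intervalIntegrable {q : ℝ → ℂ} (hq : IsWaveFunction q) (a b : ℝ) :
    IntervalIntegrable q volume a b := by
  refine hq.periodic.intervalIntegrable₀ Real.two_pi_pos.ne' ?_ a b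
  rw [intervalIntegrable_iff, uIoc_of_le Real.two_pi_pos.le]
  exact hq.memLp.integrable (by norm_num)

theorem IsWaveFunction.intervalIntegrable_norm_sq {q : ℝ → ℂ} (hq : IsWaveFunction q) (a b : ℝ) :
    IntervalIntegrable (fun x => ‖q x‖ ^ 2) volume a b := by
  have hper : Function.Periodic (fun x => ‖q x‖ ^ 2) (2 * π) := fun x => by
    simp only [hq.periodic x]
  refine hper.intervalIntegrable₀ Real.two_pi_pos.ne' ?_ a b
  rw [intervalIntegrable_iff, uIoc_of_le Real.two_pi_pos.le]
  exact (memLp_two_iff_integrable_sq_norm hq.memLp.1).1 hq.memLp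

theorem intervalIntegrable_comp_neg_half {E : Type*} [NormedAddCommGroup E] {f : ℝ → E}
    (hf : IntervalIntegrable f volume 0 (-(2 * π))) :
    IntervalIntegrable (fun a => f (-(1 / 2) * a)) volume 0 (4 * π) := by
  have h := hf.comp_mul_left (c := -(1 / 2))
  rw [zero_div, show -(2 * π) / -(1 / 2) = 4 * π by ring] at h
  exact h

theorem IsWaveFunction.aestronglyMeasurable_comp_neg_half {q : ℝ → ℂ} (hq : IsWaveFunction q) :
    AEStronglyMeasurable (fun a : ℝ => q (-(1 / 2) * a)) (volume.restrict (Icc 0 (4 * π))) := by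
  have h := intervalIntegrable_comp_neg_half (hq.intervalIntegrable 0 (-(2 * π)))
  rw [intervalIntegrable_iff_integrableOn_Icc_of_le (by positivity)] at h
  exact h.1

/-- As `a` runs over `[0, 4π]`, the point `-a/2` runs once over a period, at half speed. -/
theorem IsWaveFunction.lintegral_norm_sq_comp_neg_half {q : ℝ → ℂ} (hq : IsWaveFunction q) :
    ∫⁻ a in Icc 0 (4 * π), ‖q (-(1 / 2) * a)‖ₑ ^ 2 =
      ENNReal.ofReal (4 * π * ∑' m, ‖momentumCoeff q m‖ ^ 2) := by
  have hi := intervalIntegrable_comp_neg_half (hq.intervalIntegrable_norm_sq 0 (-(2 * π)))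
  rw [intervalIntegrable_iff_integrableOn_Icc_of_le (by positivity)] at hi
  have h1 := ofReal_integral_eq_lintegral_ofReal hi (.of_forall fun _ => by positivity)
  simp only [ENNReal.ofReal_pow (norm_nonneg _), ofReal_norm] at h1
  rw [← h1]
  congr 1
  rw [integral_Icc_eq_integral_Ioc, ← intervalIntegral.integral_of_le (by positivity),
    intervalIntegral.integral_comp_mul_left (fun x => ‖q x‖ ^ 2) (by norm_num), mul_zero,
    show -(1 / 2) * (4 * π) = -(2 * π) by ring, intervalIntegral.integral_symm,
    (hasSum_norm_sq_momentumCoeff hq).tsum_eq]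
  have hper : Function.Periodic (fun x => ‖q x‖ ^ 2) (2 * π) := fun x => by
    simp only [hq.periodic x]
  have h2 := hper.intervalIntegral_add_eq (-(2 * π)) 0
  rw [neg_add_cancel, zero_add] at h2
  rw [h2, smul_eq_mul]
  have := Real.pi_ne_zero
  field_simp
  ring

theorem isWaveFunction_shiftedPartialSum (r : ℝ → ℂ) (s : Finset ℤ) (N : ℤ) :
    IsWaveFunction (shiftedPartialSum r s N) := by
  refine .of_continuous ?_ fun x => ?_
  · unfold shiftedPartialSum
    fun_prop
  · exact Finset.sum_congr rfl fun K _ => congrArg (_ * ·) (exp_int_periodic (N - K) x)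

theorem momentumCoeff_shiftedPartialSum (r : ℝ → ℂ) (s : Finset ℤ) (N m : ℤ) :
    momentumCoeff (shiftedPartialSum r s N) m = if N - m ∈ s then momentumCoeff r m else 0 := by
  have h1 : ∀ x : ℝ, shiftedPartialSum r s N x * Complex.exp (-(I * m * x)) =
      ∑ K ∈ s, momentumCoeff r (N - K) * Complex.exp (I * (N - K - m : ℤ) * x) := fun x => by
    rw [shiftedPartialSum, Finset.sum_mul]
    refine Finset.sum_congr rfl fun K _ => ?_
    rw [mul_assoc, ← Complex.exp_add]
    push_cast
    ring_nf
  have hpi : (π : ℂ) ≠ 0 := by exact_mod_cast Real.pi_ne_zero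
  rw [momentumCoeff]
  simp only [h1]
  rw [intervalIntegral.integral_finsetSum
    fun K _ => Continuous.intervalIntegrable (by fun_prop) _ _]
  simp only [intervalIntegral.integral_const_mul, integral_exp_int]
  have h2 : ∀ K : ℤ, N - K - m = 0 ↔ K = N - m := fun K => by omega
  simp only [h2, mul_ite, mul_zero, Finset.sum_ite_eq']
  split_ifs
  · rw [sub_sub_cancel]
    field_simp
  · rfl

theorem momentumCoeff_sub {p q : ℝ → ℂ} (hp : IsWaveFunction p) (hq : IsWaveFunction q) (m : ℤ) :
    momentumCoeff (fun x => p x - q x) m = momentumCoeff p m - momentumCoeff q m := by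
  have hc : ContinuousOn (fun x : ℝ => Complex.exp (-(I * m * x))) (uIcc 0 (2 * π)) :=
    Continuous.continuousOn (by fun_prop)
  simp only [momentumCoeff, sub_mul]
  rw [intervalIntegral.integral_sub ((hp.intervalIntegrable _ _).mul_continuousOn hc)
    ((hq.intervalIntegrable _ _).mul_continuousOn hc), mul_sub]

/-- The sum of `|r_m|²` over the frequencies `m` that do not occur in `shiftedPartialSum r s N`, that
is, over the `m` with `N - m ∉ s`. -/
noncomputable def missedWeight (r : ℝ → ℂ) (s : Finset ℤ) (N : ℤ) : ℝ :=
  ∑' m, if N - m ∈ s then 0 else ‖momentumCoeff r m‖ ^ 2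

theorem missedWeight_nonneg (r : ℝ → ℂ) (s : Finset ℤ) (N : ℤ) : 0 ≤ missedWeight r s N :=
  tsum_nonneg fun m => by split_ifs <;> positivity

theorem missedWeight_le {r : ℝ → ℂ} (hr : IsWaveFunction r) (s : Finset ℤ) (N : ℤ) :
    missedWeight r s N ≤ ∑' m, ‖momentumCoeff r m‖ ^ 2 := by
  have hle : ∀ m, (if N - m ∈ s then 0 else ‖momentumCoeff r m‖ ^ 2) ≤
      ‖momentumCoeff r m‖ ^ 2 := fun m => by split_ifs <;> simp
  exact Summable.tsum_le_tsum hle (.of_nonneg_of_le (fun m => by split_ifs <;> positivity) hle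
    hr.summable_sq) hr.summable_sq

theorem tendsto_missedWeight {r : ℝ → ℂ} (hr : IsWaveFunction r) (N : ℤ) :
    Tendsto (fun s => missedWeight r s N) atTop (𝓝 0) := by
  have h := tendsto_tsum_of_dominated_convergence (𝓕 := (atTop : Filter (Finset ℤ)))
    (f := fun s m => if N - m ∈ s then 0 else ‖momentumCoeff r m‖ ^ 2) (g := fun _ => (0 : ℝ))
    hr.summable_sq (fun m => ?_) (.of_forall fun s m => ?_)
  · rw [tsum_zero] at h
    exact h
  · refine tendsto_const_nhds.congr' ?_
    filter_upwards [eventually_ge_atTop {N - m}] with s hs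
    rw [if_pos (hs (Finset.mem_singleton_self _))]
  · split_ifs <;> simp

theorem lintegral_norm_sq_shiftedPartialSum_sub {r : ℝ → ℂ} (hr : IsWaveFunction r)
    (s : Finset ℤ) (N : ℤ) :
    ∫⁻ a in Icc 0 (4 * π), ‖shiftedPartialSum r s N (-(1 / 2) * a) - r (-(1 / 2) * a)‖ₑ ^ 2 =
      ENNReal.ofReal (4 * π * missedWeight r s N) := by
  have hp := isWaveFunction_shiftedPartialSum r s N
  rw [(hp.sub hr).lintegral_norm_sq_comp_neg_half, missedWeight]
  congr 3
  funext m
  rw [momentumCoeff_sub hp hr, momentumCoeff_shiftedPartialSum]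
  split_ifs <;> simp

/-- The squared distance is at most a constant times `∑_N ‖gaussMode N z‖ · missedWeight r s N`,
which tends to zero by dominated convergence. -/
theorem tendsto_eLpNorm_sum_coherentRep {r : ℝ → ℂ} (hr : IsWaveFunction r) (z : ℂ) :
    Tendsto (fun s : Finset ℤ => eLpNorm (fun a : ℝ => ∑ K ∈ s, coherentRep z a K r -
      2 * π * r (-(1 / 2) * a) * theta3 ((a - 2 * z) / 4) (I / (2 * π))) 2
        (volume.restrict (Icc 0 (4 * π)))) atTop (𝓝 0) := by
  set w : ℤ → ℝ := fun N => 2 * π * ‖gaussMode N z‖ with hw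
  have hw0 : ∀ N, 0 ≤ w N := fun N => by positivity
  have hws : Summable w := (summable_norm_gaussMode z).mul_left _
  have hpt : ∀ (s : Finset ℤ) (a : ℝ), ‖∑ K ∈ s, coherentRep z a K r -
      2 * π * r (-(1 / 2) * a) * theta3 ((a - 2 * z) / 4) (I / (2 * π))‖ₑ ^ 2 ≤
      2 * ENNReal.ofReal (∑' N, w N) * ∑' N, ENNReal.ofReal (w N) *
        ‖shiftedPartialSum r s N (-(1 / 2) * a) - r (-(1 / 2) * a)‖ₑ ^ 2 := fun s a => by
    rw [← ((hasSum_sum_coherentRep hr z a s).sub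
      (hasSum_theta3_marginal z a (r (-(1 / 2) * a)))).tsum_eq]
    rw [ENNReal.ofReal_tsum_of_nonneg hw0 hws]
    refine le_trans ?_ (ennreal_sq_tsum_mul_le _ _)
    gcongr
    refine enorm_tsum_le_tsum_enorm.trans (le_of_eq (tsum_congr fun N => ?_))
    rw [← mul_sub, enorm_mul, ← ofReal_norm (2 * (π : ℂ) * _), norm_marginal_weight]
  have hint : ∀ s : Finset ℤ, ∫⁻ a in Icc 0 (4 * π), ‖∑ K ∈ s, coherentRep z a K r -
      2 * π * r (-(1 / 2) * a) * theta3 ((a - 2 * z) / 4) (I / (2 * π))‖ₑ ^ 2 ≤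
      2 * ENNReal.ofReal (∑' N, w N) *
        ENNReal.ofReal (∑' N, w N * (4 * π * missedWeight r s N)) := fun s => by
    refine (lintegral_mono (hpt s)).trans ?_
    have hm : ∀ N, AEMeasurable (fun a : ℝ => ENNReal.ofReal (w N) *
        ‖shiftedPartialSum r s N (-(1 / 2) * a) - r (-(1 / 2) * a)‖ₑ ^ 2)
        (volume.restrict (Icc 0 (4 * π))) := fun N =>
      ((((isWaveFunction_shiftedPartialSum r s N).sub
        hr).aestronglyMeasurable_comp_neg_half.enorm).pow_const 2).const_mul _
    rw [lintegral_const_mul' _ _ (by finiteness), lintegral_tsum hm]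
    gcongr
    rw [ENNReal.ofReal_tsum_of_nonneg]
    · refine (tsum_congr fun N => ?_).le
      rw [lintegral_const_mul' _ _ ENNReal.ofReal_ne_top,
        lintegral_norm_sq_shiftedPartialSum_sub hr, ENNReal.ofReal_mul (hw0 N)]
    · exact fun N => mul_nonneg (hw0 N) (mul_nonneg (by positivity) (missedWeight_nonneg _ _ _))
    · refine .of_nonneg_of_le
        (fun N => mul_nonneg (hw0 N) (mul_nonneg (by positivity) (missedWeight_nonneg _ _ _)))
        (fun N => ?_) (hws.mul_right (4 * π * ∑' m, ‖momentumCoeff r m‖ ^ 2))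
      have := missedWeight_le hr s N
      have := hw0 N
      gcongr
  have hlim : Tendsto (fun s : Finset ℤ => ∑' N, w N * (4 * π * missedWeight r s N)) atTop
      (𝓝 0) := by
    have h := tendsto_tsum_of_dominated_convergence (𝓕 := (atTop : Filter (Finset ℤ)))
      (f := fun s N => w N * (4 * π * missedWeight r s N)) (g := fun _ => (0 : ℝ))
      (hws.mul_right (4 * π * ∑' m, ‖momentumCoeff r m‖ ^ 2)) (fun N => ?_)
      (.of_forall fun s N => ?_)
    · rw [tsum_zero] at h
      exact h
    · simpa using ((tendsto_missedWeight hr N).const_mul (4 * π)).const_mul (w N)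
    · have h1 := missedWeight_le hr s N
      have h2 := missedWeight_nonneg r s N
      have h3 := hw0 N
      rw [Real.norm_of_nonneg (by positivity)]
      gcongr
  have hlim2 : Tendsto (fun s : Finset ℤ => ∫⁻ a in Icc 0 (4 * π), ‖∑ K ∈ s, coherentRep z a K r -
      2 * π * r (-(1 / 2) * a) * theta3 ((a - 2 * z) / 4) (I / (2 * π))‖ₑ ^ 2) atTop (𝓝 0) := by
    refine tendsto_of_tendsto_of_tendsto_of_le_of_le tendsto_const_nhds ?_
      (fun s => zero_le) hint
    have h := ENNReal.Tendsto.const_mul (a := 2 * ENNReal.ofReal (∑' N, w N))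
      (ENNReal.tendsto_ofReal hlim) (.inr (by finiteness))
    rwa [ENNReal.ofReal_zero, mul_zero] at h
  have h := (ENNReal.continuous_rpow_const (y := 1 / 2)).tendsto 0 |>.comp hlim2
  rw [ENNReal.zero_rpow_of_pos (by norm_num)] at h
  refine h.congr fun s => ?_
  rw [eLpNorm_eq_lintegral_rpow_enorm_toReal two_ne_zero ENNReal.ofNat_ne_top]
  simp

/-! ### Zeros of coherent states -/

theorem zeros_coherentRep {r : ℝ → ℂ} (hr : IsWaveFunction r) (a : ℝ) (K : ℤ) :
    {z : ℂ | coherentRep z a K r = 0} =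
      (fun ζ : ℂ => ζ - I * K + a) '' {ζ : ℂ | analyticRep r ζ = 0} := by
  ext z
  simp only [Set.mem_ofPred_eq, Set.mem_image]
  rw [coherentRep_eq_exp_mul hr, mul_eq_zero, or_iff_right (Complex.exp_ne_zero _)]
  constructor
  · intro h
    exact ⟨_, h, by ring⟩
  · rintro ⟨ζ, h, rfl⟩
    rw [← h]
    congr 1
    ring

theorem analyticOrderAt_coherentRep {r : ℝ → ℂ} (hr : IsWaveFunction r) (a : ℝ) (K : ℤ) (ζ : ℂ) :
    analyticOrderAt (fun z => coherentRep z a K r) (ζ - I * K + a) =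
      analyticOrderAt (analyticRep r) ζ := by
  set u : ℂ → ℂ := fun z => Complex.exp (-(1 / 2) * I * K * a + I * K * z - 1 / 2 * (K : ℂ) ^ 2)
  set v : ℂ → ℂ := fun z => z + I * K - a
  have hv0 : v (ζ - I * K + a) = ζ := by simp only [v]; ring
  have hu : AnalyticAt ℂ u (ζ - I * K + a) :=
    Differentiable.analyticAt (by fun_prop) _
  have hv : AnalyticAt ℂ v (ζ - I * K + a) :=
    Differentiable.analyticAt (by fun_prop) _
  have hR : AnalyticAt ℂ (analyticRep r) (v (ζ - I * K + a)) :=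
    (differentiable_analyticRep hr).analyticAt _
  have hfun : (fun z => coherentRep z a K r) = u * (analyticRep r ∘ v) :=
    funext fun z => coherentRep_eq_exp_mul hr z a K
  have hdv : deriv v (ζ - I * K + a) ≠ 0 := by
    have : deriv v (ζ - I * K + a) = 1 := by
      simp only [v]
      simp
    rw [this]
    exact one_ne_zero
  have hu0 : analyticOrderAt u (ζ - I * K + a) = 0 :=
    hu.analyticOrderAt_eq_zero.2 (Complex.exp_ne_zero _)
  rw [hfun, analyticOrderAt_mul hu (hR.comp hv), hu0, zero_add,
    analyticOrderAt_comp_of_deriv_ne_zero hv hdv, hv0]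

end CircleQM

open CircleQM in
theorem proposition2 (r : ℝ → ℂ) (hr : IsState r) (q : ℝ → ℂ) (hq : IsWaveFunction q) :
    -- (1) Fourier-type transform
    (∀ (z : ℂ) (a : ℝ) (K : ℤ),
      (∀ M : ℤ, IntervalIntegrable (fun b : ℝ => coherentRep z b (2 * M - K) r *
        Complex.exp (I / 2 * (-(b * K) - a * K + 2 * M * a))) MeasureTheory.volume 0 (2 * π)) ∧
      Summable (fun M : ℤ => ∫ b in (0 : ℝ)..2 * π, coherentRep z b (2 * M - K) r *
        Complex.exp (I / 2 * (-(b * K) - a * K + 2 * M * a))) ∧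
      coherentRep (-z) a K r = 1 / (2 * π) * ∑' M : ℤ, ∫ b in (0 : ℝ)..2 * π,
        coherentRep z b (2 * M - K) r *
          Complex.exp (I / 2 * (-(b * K) - a * K + 2 * M * a))) ∧
    -- (2) relation to the fiducial vector, and the zeros (as a set and with multiplicities)
    (∀ (a : ℝ) (K : ℤ),
      (∀ z : ℂ, coherentRep z a K r =
        Complex.exp (-(1 / 2) * I * K * a + I * K * z - 1 / 2 * (K : ℂ) ^ 2) *
          analyticRep r (z + I * K - a)) ∧
      Differentiable ℂ (analyticRep r) ∧
      Differentiable ℂ (fun z => coherentRep z a K r) ∧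
      {z : ℂ | coherentRep z a K r = 0} =
        (fun ζ : ℂ => ζ - I * K + a) '' {ζ : ℂ | analyticRep r ζ = 0} ∧
      (∀ ζ : ℂ, analyticOrderAt (fun z => coherentRep z a K r) (ζ - I * K + a) =
        analyticOrderAt (analyticRep r) ζ)) ∧
    -- (3) resolution of the identity, and symmetry of the kernel
    (∀ z w : ℂ,
      (∀ K : ℤ, IntervalIntegrable (fun a : ℝ => coherentRep z a K r * conj (coherentRep w a K r))
        MeasureTheory.volume 0 (2 * π)) ∧
      Summable (fun K : ℤ => ∫ a in (0 : ℝ)..2 * π,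
        coherentRep z a K r * conj (coherentRep w a K r)) ∧
      1 / (4 * (π : ℂ) ^ 2) * ∑' K : ℤ, ∫ a in (0 : ℝ)..2 * π,
        coherentRep z a K r * conj (coherentRep w a K r) = kernel z (conj w) ∧
      kernel z (conj w) = kernel (-z) (-conj w)) ∧
    -- (4) reproducing kernel relation
    (∀ z : ℂ,
      MeasureTheory.IntegrableOn (fun w => kernel z (conj w) * analyticRep q w) strip dm ∧
      analyticRep q z = ∫ w in strip, kernel z (conj w) * analyticRep q w ∂dm) ∧
    -- (5) expansion in coherent states with coefficients `q(a,K;r)`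
    (∀ z : ℂ,
      (∀ K : ℤ, IntervalIntegrable (fun a : ℝ => coherentRep z a K r * coeff q a K r)
        MeasureTheory.volume 0 (2 * π)) ∧
      Summable (fun K : ℤ => ∫ a in (0 : ℝ)..2 * π, coherentRep z a K r * coeff q a K r) ∧
      analyticRep q z = 1 / (2 * π) * ∑' K : ℤ, ∫ a in (0 : ℝ)..2 * π,
        coherentRep z a K r * coeff q a K r) ∧
    (∀ (a : ℝ) (K : ℤ), coeff q (a + 2 * π) K r = (-1) ^ K * coeff q a K r) ∧
    -- (5) expansion with coefficients `q̃(b,M;r)`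
    (∀ z : ℂ,
      (∀ M : ℤ, IntervalIntegrable (fun b : ℝ => coherentRep (-z) b M r * coeffTilde q b M r)
        MeasureTheory.volume 0 (2 * π)) ∧
      Summable (fun M : ℤ => ∫ b in (0 : ℝ)..2 * π,
        coherentRep (-z) b M r * coeffTilde q b M r) ∧
      analyticRep q z = 1 / (2 * π) * ∑' M : ℤ, ∫ b in (0 : ℝ)..2 * π,
        coherentRep (-z) b M r * coeffTilde q b M r) ∧
    (∀ (b : ℝ) (M : ℤ), coeffTilde q (b + 2 * π) M r = (-1) ^ M * coeffTilde q b M r) ∧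
    -- (5) the inverse relations
    (∀ (a : ℝ) (K : ℤ),
      MeasureTheory.IntegrableOn (fun w => conj (coherentRep w a K r) * analyticRep q w) strip dm ∧
      coeff q a K r =
        1 / (2 * π) * ∫ w in strip, conj (coherentRep w a K r) * analyticRep q w ∂dm) ∧
    (∀ (b : ℝ) (M : ℤ),
      MeasureTheory.IntegrableOn (fun w => conj (coherentRep (-w) b M r) * analyticRep q w)
        strip dm ∧
      coeffTilde q b M r =
        1 / (2 * π) * ∫ w in strip, conj (coherentRep (-w) b M r) * analyticRep q w ∂dm) ∧
    -- (5) relation between the two families of coefficients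
    (∀ (b : ℝ) (M : ℤ),
      (∀ K : ℤ, IntervalIntegrable (fun a : ℝ => coeff q (-a) (M - 2 * K) r *
        Complex.exp (I / 2 * (-(a * M) - b * M + 2 * K * b))) MeasureTheory.volume 0 (2 * π)) ∧
      Summable (fun K : ℤ => ∫ a in (0 : ℝ)..2 * π, coeff q (-a) (M - 2 * K) r *
        Complex.exp (I / 2 * (-(a * M) - b * M + 2 * K * b))) ∧
      coeffTilde q b M r = 1 / (2 * π) * ∑' K : ℤ, ∫ a in (0 : ℝ)..2 * π,
        coeff q (-a) (M - 2 * K) r *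
          Complex.exp (I / 2 * (-(a * M) - b * M + 2 * K * b))) ∧
    -- (6) first marginal property: in mean square over a period of `a`, and pointwise at every
    -- `a` such that the Fourier series of `r` converges to `r` at `-a/2`
    (∀ z : ℂ, Filter.Tendsto
      (fun s : Finset ℤ => MeasureTheory.eLpNorm
        (fun a : ℝ => ∑ K ∈ s, coherentRep z a K r -
          2 * π * r (-(1 / 2) * a) * theta3 ((a - 2 * z) / 4) (I / (2 * π)))
        2 (MeasureTheory.volume.restrict (Set.Icc 0 (4 * π))))
      Filter.atTop (𝓝 0)) ∧
    (∀ (z : ℂ) (a : ℝ),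
      Filter.Tendsto (fun n : ℕ => ∑ N ∈ Finset.Icc (-(n : ℤ)) n,
        momentumCoeff r N * Complex.exp (I * N * (-(1 / 2) * a))) Filter.atTop
        (𝓝 (r (-(1 / 2) * a))) →
      Filter.Tendsto (fun n : ℕ => ∑ K ∈ Finset.Icc (-(n : ℤ)) n, coherentRep z a K r)
        Filter.atTop
        (𝓝 (2 * π * r (-(1 / 2) * a) * theta3 ((a - 2 * z) / 4) (I / (2 * π))))) ∧
    -- (6) second marginal property
    (∀ (z : ℂ) (K : ℤ),
      IntervalIntegrable (fun a : ℝ => coherentRep z a (-2 * K) r)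
        MeasureTheory.volume 0 (2 * π) ∧
      ∫ a in (0 : ℝ)..2 * π, coherentRep z a (-2 * K) r =
        4 * (π : ℂ) ^ 2 * momentumCoeff r K *
          Complex.exp (-(I * z * K) - 1 / 2 * (K : ℂ) ^ 2)) := by
  have hr' := hr.toIsWaveFunction
  have hpi : (π : ℂ) ≠ 0 := by exact_mod_cast Real.pi_ne_zero
  have h2pi : ∀ c : ℂ, 1 / (2 * (π : ℂ)) * (2 * π * c) = c := fun c => by field_simp
  have h4pi : ∀ c : ℂ, 1 / (4 * (π : ℂ) ^ 2) * (4 * π ^ 2 * c) = c := fun c => by field_simp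
  refine ⟨fun z a K => ⟨fun M => ?_, ?_, ?_⟩, fun a K => ⟨fun z => ?_, ?_, ?_, ?_, fun ζ => ?_⟩,
    fun z w => ⟨fun K => ?_, ?_, ?_, ?_⟩, fun z => reproducing_kernel hq z,
    fun z => ⟨fun K => ?_, ?_, ?_⟩, fun a K => ?_, fun z => ⟨fun M => ?_, ?_, ?_⟩, fun b M => ?_,
    fun a K => integral_strip_conj_coherentRep_mul hr' hq a K, fun b M => ?_,
    fun b M => ⟨fun K => ?_, ?_, ?_⟩, fun z => tendsto_eLpNorm_sum_coherentRep hr' z,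
    fun z a h => ?_, fun z K => ⟨?_, integral_coherentRep hr' z K⟩⟩
  · have := continuous_coherentRep hr' z (2 * M - K)
    exact Continuous.intervalIntegrable (by fun_prop) _ _
  · exact (hasSum_integral_coherentRep_mul_exp hr' z a K).summable
  · rw [(hasSum_integral_coherentRep_mul_exp hr' z a K).tsum_eq, h2pi]
  · exact coherentRep_eq_exp_mul hr' z a K
  · exact differentiable_analyticRep hr'
  · exact differentiable_analyticRep (hr'.displacement a K)
  · exact zeros_coherentRep hr' a K
  · exact analyticOrderAt_coherentRep hr' a K ζ
  · have h1 := continuous_coherentRep hr' z K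
    have h2 := continuous_coherentRep hr' w K
    exact (h1.mul (Complex.continuous_conj.comp h2)).intervalIntegrable _ _
  · exact (hasSum_integral_coherentRep_mul_conj hr z w).summable
  · rw [(hasSum_integral_coherentRep_mul_conj hr z w).tsum_eq, h4pi]
  · exact kernel_neg z w
  · exact ((continuous_coherentRep hr' z K).mul (continuous_coeff hr' hq K)).intervalIntegrable _ _
  · exact (hasSum_integral_coherentRep_mul_coeff hr hq z).summable
  · rw [(hasSum_integral_coherentRep_mul_coeff hr hq z).tsum_eq, h2pi]
  · exact coeff_add_two_pi r q hq.periodic a K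
  · have h1 := continuous_coherentRep hr' (-z) M
    have h2 : Continuous fun b : ℝ => coeffTilde q b M r := by
      simp only [coeffTilde_eq hr' hq]
      exact (continuous_coeff hr'.parity hq (-M)).comp continuous_neg
    exact (h1.mul h2).intervalIntegrable _ _
  · exact (hasSum_integral_coherentRep_mul_coeffTilde hr hq z).summable
  · rw [(hasSum_integral_coherentRep_mul_coeffTilde hr hq z).tsum_eq, h2pi]
  · exact coeffTilde_add_two_pi hr' hq b M
  · simp only [coherentRep_neg hr', coeffTilde_eq hr' hq]
    exact integral_strip_conj_coherentRep_mul hr'.parity hq (-b) (-M)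
  · have h1 := (continuous_coeff hr' hq (M - 2 * K)).comp continuous_neg
    exact (h1.mul (by fun_prop)).intervalIntegrable _ _
  · exact (hasSum_integral_coeff_mul_exp hr' hq b M).summable
  · rw [(hasSum_integral_coeff_mul_exp hr' hq b M).tsum_eq, h2pi]
  · refine tendsto_sum_coherentRep hr' z a ?_
    push_cast
    exact h
  · exact (continuous_coherentRep hr' z (-2 * K)).intervalIntegrable _ _
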